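/- **Model.** A network has $n\ge 1$ nodes with unique identities; each node can access $c$ channels, known to it only under local labels (there is no global labelling; different nodes may access different channels). Two nodes are neighbors if they are within transmission range of each other and share at least one channel. Every two neighbors share at least $k$ and at most $k_{max}$ channels, where $1\le k\le k_{max}\le c$, and every node has at most $\Delta\le n-1$ neighbors. Time is divided into synchronous slots, and all nodes start simultaneously. In each slot a node broadcasts a message on one of its channels, listens on one of its channels, or is idle. A listener on a channel receives a message if and only if exactly one of its neighbors broadcasts on that channel in that slot; otherwise it hears nothing (there is no collision detection). Nodes know $n,c,k,k_{max},\Delta$ and their own identity and have independent random bits. *Neighbor discovery* is solved if every node outputs exactly the set of identities of its neighbors. **Algorithm CSeek.** Let $\lg=\log_2$ and $L=\max(1,\lceil\lg\Delta\rceil)$, and let $a,C_1,C_2>0$ and $0<\delta<1$ be constants. *Part one* has $\lceil C_1 (c^2/k)\lg n\rceil$ steps of $L\cdot\lceil a\lg n\rceil$ slots. In each step each node chooses one of its channels uniformly at random and independently becomes broadcaster or listener with probability $1/2$ each, and runs the procedure Count on that channel: in round $i=1,\dots,L$, consisting of $\lceil a\lg n\rceil$ slots, a broadcaster broadcasts its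 identity in each slot with probability $2^{-(i-1)}$ (and is idle otherwise), while a listener listens. The count obtained by a listener is $2^{i+1}$ for the first round $i$ in which it hears messages in more than a $(1+\delta)\,8e^{-7}$ fraction of the slots, and $0$ if there is no such round. Each node $u$ adds up its counts for each of its channels $ch$, with total $x_{ch}$. *Part two* has $\lceil C_2 (k_{max}/k)\,\Delta\lg n\rceil$ steps of $L$ slots. In each step each node is a broadcaster or a listener with probability $1/2$ each. A broadcaster chooses one of its channels uniformly at random and broadcasts its identity on it in slot $i=1,\dots,L$ of the step with probability $2^{i-1}/2^{L}$. A listener listens during the step on a channel $ch$ chosen with probability $x_{ch}/\sum_{ch'}x_{ch'}$ (it stays idle if all its totals are $0$). At the end each node outputs all identities it has heard in the two parts. **Theorem.** There is $\delta_0\in(0,1]$ such that for every $\delta\in(0,\delta_0)$ and every $\alpha\ge 1$ there are constants $a,C_1,C_2,C>0$ such that in every network as above CSeek with the constants $\delta,a,C_1,C_2$ solves neighbor discovery with probability at least $1-1/n^{\alpha}$, and the number of its slots is at most $$C\left(\frac{c^2}{k}\lg^3 n+\frac{k_{max}}{k}\,\Delta\,\lg^2 n\right)$$ and at most $C\left(\frac{c^2}{k}+\frac{k_{max}}{k}\Delta\right)\lg^3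 n$, i.e. it is $\tilde O\left(\frac{c^2}{k}+\frac{k_{max}}{k}\Delta\right)$. -/

import Mathlib

open MeasureTheory

universe u v

/-- The binary logarithm. -/
noncomputable def lg (x : ℝ) : ℝ := Real.logb 2 x

/-! ### Cognitive radio networks -/

/-- A network with node set `V`, whose elements also serve as the unique identities of the nodes.
Each node has access to `c` channels out of an arbitrary set `Ch`, which it knows only under its own
local labels `Fin c`; `channel u ℓ` is the channel that `u` calls `ℓ`. -/
structure CRNetwork (V : Type u) (Ch : Type v) (c : ℕ) where
  /-- two different nodes are within transmission range of each other -/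
  range : SimpleGraph V
  channel : V → Fin c ↪ Ch

namespace CRNetwork

variable {V : Type u} {Ch : Type v} {c : ℕ} (N : CRNetwork V Ch c)

/-- The channels to which both `u` and `v` have access. -/
def shared (u v : V) : Set Ch := Set.range (N.channel u) ∩ Set.range (N.channel v)

/-- Neighbors: two nodes within transmission range that share at least one channel. -/
def graph : SimpleGraph V where
  Adj u v := N.range.Adj u v ∧ (N.shared u v).Nonempty
  symm := ⟨fun _ _ h => ⟨h.1.symm, by simpa only [shared, Set.inter_comm] using h.2⟩⟩
  loopless := ⟨fun _ h => h.1.ne rfl⟩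

/-- Neighbors share at least `k` and at most `kmax` channels, where `1 ≤ k ≤ kmax ≤ c`,
and every node has at most `Δ` neighbors, where `Δ ≤ n - 1` for the number `n` of nodes. -/
structure HasBounds [Fintype V] (k kmax Δ : ℕ) : Prop where
  one_le_k : 1 ≤ k
  k_le_kmax : k ≤ kmax
  kmax_le_c : kmax ≤ c
  overlap : ∀ u v, N.graph.Adj u v → k ≤ (N.shared u v).ncard ∧ (N.shared u v).ncard ≤ kmax
  degree_le : ∀ u, (N.graph.neighborSet u).ncard ≤ Δ
  Δ_lt : Δ < Fintype.card V

end CRNetwork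

/-- What a node can do with its transceiver in one slot; channels are given by local labels. -/
inductive RadioAction (c : ℕ) (M : Type u) : Type u
  | broadcast (ch : Fin c) (msg : M)
  | listen (ch : Fin c)
  | idle

open Classical in
/-- What node `u` hears in a slot in which every node `v` performs `acts v`. A listener hears a
message iff exactly one of its neighbors broadcasts on its channel; silence and collisions are
indistinguishable (both are `none`). -/
noncomputable def CRNetwork.received {V : Type u} {Ch : Type v} {c : ℕ} {M : Type*}
    (N : CRNetwork V Ch c) (acts : V → RadioAction c M) (u : V) : Option M :=
  match acts u with
  | .listen ch =>
      if h : ∃! p : V × M, N.graph.Adj u p.1 ∧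
          ∃ ch' : Fin c, acts p.1 = .broadcast ch' p.2 ∧ N.channel p.1 ch' = N.channel u ch
      then some h.exists.choose.2 else none
  | _ => none

/-! ### Synchronous randomized protocols -/

/-- A randomized distributed protocol, executed by every node with identities in `Id`, with messages
that are identities. Each node has its own random tape, drawn from `law`. In slot `t = 0, 1, …` the
action of a node depends on its identity, its tape, `t`, and what it heard in the previous slots (a
function of the slot number that is `none` for all slots from `t` on). After `slots` slots the node
returns a set of identities. -/
structure Protocol (Id : Type u) (c : ℕ) where
  Rand : Type
  [measurableSpace : MeasurableSpace Rand]
  law : Measure Rand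
  [isProbabilityMeasure : IsProbabilityMeasure law]
  slots : ℕ
  action : Id → Rand → ℕ → (ℕ → Option Id) → RadioAction c Id
  output : Id → Rand → (ℕ → Option Id) → Set Id

attribute [instance] Protocol.measurableSpace Protocol.isProbabilityMeasure

namespace Protocol

variable {V : Type u} {Ch : Type v} {c : ℕ} (P : Protocol V c) (N : CRNetwork V Ch c)

/-- `P.history N ω t u s` is what node `u` has heard in slot `s`, as recorded after the first `t`
slots, when all nodes of `N` start `P` simultaneously with the random tapes `ω`. -/
noncomputable def history (ω : V → P.Rand) : ℕ → V → ℕ → Option V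
  | 0 => fun _ _ => none
  | t + 1 => fun u => Function.update (history ω t u) t
      (N.received (fun v => P.action v (ω v) t (history ω t v)) u)

/-- The set of tapes for which neighbor discovery is solved: every node returns precisely the set of
its neighbors. -/
def discovers : Set (V → P.Rand) :=
  {ω | ∀ u, P.output u (ω u) (P.history N ω P.slots u) = N.graph.neighborSet u}

/-- The probability that `P` solves neighbor discovery in `N`; the tapes of the nodes are
independent. -/
noncomputable def discoveryProb [Fintype V] : ℝ :=
  (Measure.pi fun _ : V => P.law).real (P.discovers N)

end Protocol

/-! ### The algorithm CSeek -/

namespace CSeek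

/-- The numerical data of a run of CSeek. -/
structure Shape where
  /-- number of rounds of the counting procedure; also number of slots of a step of part two -/
  rounds : ℕ
  /-- number of slots of a round of the counting procedure -/
  roundLen : ℕ
  /-- number of steps of part one -/
  steps₁ : ℕ
  /-- number of steps of part two -/
  steps₂ : ℕ
  /-- fraction of slots with a message above which a round of the counting procedure is accepted -/
  threshold : ℝ

variable {c : ℕ} (S : Shape)

/-- The number of slots of part one. -/
def Shape.slots₁ : ℕ := S.steps₁ * (S.rounds * S.roundLen)

/-- The number of slots of part two. -/
def Shape.slots₂ : ℕ := S.steps₂ * S.rounds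

/-- An upper bound on the sum of all counts that a node can obtain in part one. -/
def Shape.maxTotal : ℕ := S.steps₁ * 2 ^ (S.rounds + 1)

/-- All random draws of one node. The value `true` of a role means broadcaster. Rounds and slots are
numbered from `0`. A coin with values in `Fin m` shows heads if it is `0`, i.e. with probability
`1 / m`. In part two a listener needs a random element of `{1, …, sum}`, where `sum` depends
on the execution; therefore the tape holds a draw from `Fin m` for every possible value `m` of
`sum` (`draw₂ s i` is the one for `m = i + 1`), of which only one is used. -/
structure Tape (c : ℕ) (S : Shape) where
  channel₁ : Fin S.steps₁ → Fin c
  role₁ : Fin S.steps₁ → Bool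
  coin₁ : Fin S.steps₁ → (i : Fin S.rounds) → Fin S.roundLen → Fin (2 ^ (i : ℕ))
  role₂ : Fin S.steps₂ → Bool
  channel₂ : Fin S.steps₂ → Fin c
  coin₂ : Fin S.steps₂ → (j : Fin S.rounds) → Fin (2 ^ (S.rounds - (j : ℕ)))
  draw₂ : Fin S.steps₂ → (i : Fin S.maxTotal) → Fin ((i : ℕ) + 1)

/-- A tape is the tuple of its components. -/
def Tape.equiv (c : ℕ) (S : Shape) : Tape c S ≃
    (Fin S.steps₁ → Fin c) × (Fin S.steps₁ → Bool) ×
    (Fin S.steps₁ → (i : Fin S.rounds) → Fin S.roundLen → Fin (2 ^ (i : ℕ))) ×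
    (Fin S.steps₂ → Bool) × (Fin S.steps₂ → Fin c) ×
    (Fin S.steps₂ → (j : Fin S.rounds) → Fin (2 ^ (S.rounds - (j : ℕ)))) ×
    (Fin S.steps₂ → (i : Fin S.maxTotal) → Fin ((i : ℕ) + 1)) where
  toFun ω := (ω.channel₁, ω.role₁, ω.coin₁, ω.role₂, ω.channel₂, ω.coin₂, ω.draw₂)
  invFun x := ⟨x.1, x.2.1, x.2.2.1, x.2.2.2.1, x.2.2.2.2.1, x.2.2.2.2.2.1, x.2.2.2.2.2.2⟩
  left_inv _ := rfl
  right_inv _ := rfl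

instance : Fintype (Tape c S) := Fintype.ofEquiv _ (Tape.equiv c S).symm

instance [NeZero c] : Nonempty (Tape c S) :=
  ⟨⟨fun _ => 0, fun _ => true, fun _ i _ => ⟨0, by positivity⟩, fun _ => true, fun _ => 0,
    fun _ j => ⟨0, by positivity⟩, fun _ _ => 0⟩⟩

instance : MeasurableSpace (Tape c S) := ⊤

instance : DiscreteMeasurableSpace (Tape c S) := ⟨fun _ => trivial⟩

variable {S} {Id : Type u}

/-- The number of the slot `j` in round `i` in step `s` of part one. -/
def slot₁ (s : Fin S.steps₁) (i : Fin S.rounds) (j : Fin S.roundLen) : ℕ :=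
  finProdFinEquiv (s, finProdFinEquiv (i, j))

/-- The number of messages heard in round `i` of the counting procedure in step `s` of part one,
where `h t` is what has been heard in slot `t`. -/
def heard (h : ℕ → Option Id) (s : Fin S.steps₁) (i : Fin S.rounds) : ℕ :=
  (Finset.univ.filter fun j : Fin S.roundLen => (h (slot₁ s i j)).isSome).card

/-- Messages have been heard in more than the threshold fraction of the slots of round `i`. -/
def Accepts (h : ℕ → Option Id) (s : Fin S.steps₁) (i : Fin S.rounds) : Prop :=
  S.threshold * S.roundLen < heard h s i

open Classical in
/-- The result of the counting procedure in step `s` of part one: if the first accepted round is the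
`r`-th one (so `r = i + 1`), then it is `2 ^ (r + 1)`; if no round is accepted, then it is `0`. -/
noncomputable def count (h : ℕ → Option Id) (s : Fin S.steps₁) : ℕ :=
  ∑ i : Fin S.rounds, if Accepts h s i ∧ ∀ i' < i, ¬ Accepts h s i' then 2 ^ ((i : ℕ) + 2) else 0

/-- The total count obtained in part one for the channel with label `ch`. (In steps in which the node
is a broadcaster it hears nothing and its count is `0`.) -/
noncomputable def counts (ω : Tape c S) (h : ℕ → Option Id) (ch : Fin c) : ℕ :=
  ∑ s : Fin S.steps₁, if ω.channel₁ s = ch then count h s else 0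

theorem count_le (h : ℕ → Option Id) (s : Fin S.steps₁) : count h s ≤ 2 ^ (S.rounds + 1) := by
  classical
  unfold count
  by_cases hex : ∃ i, Accepts h s i ∧ ∀ i' < i, ¬ Accepts h s i'
  · obtain ⟨i, hi⟩ := hex
    rw [Finset.sum_eq_single i]
    · rw [if_pos hi]
      exact Nat.pow_le_pow_right (by norm_num) (by have := i.isLt; omega)
    · intro b _ hb
      rw [if_neg]
      rintro ⟨h1, h2⟩
      rcases lt_or_gt_of_ne hb with hlt | hgt
      · exact hi.2 b hlt h1
      · exact h2 i hgt hi.1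
    · simp
  · rw [Finset.sum_eq_zero]
    · positivity
    · intro i _
      rw [if_neg]
      exact fun hi => hex ⟨i, hi⟩

theorem sum_counts_le (ω : Tape c S) (h : ℕ → Option Id) :
    ∑ ch, counts ω h ch ≤ S.maxTotal := by
  unfold counts
  rw [Finset.sum_comm]
  simp only [Finset.sum_ite_eq, Finset.mem_univ, if_true]
  exact (Finset.sum_le_sum fun s _ => count_le h s).trans (by simp [Shape.maxTotal])

/-- The channel selected by the number `rnd`: the first one at which the partial sums of `x` reach
`rnd`. For a uniformly random `rnd` in `{1, …, ∑ ch, x ch}` it is `ch` with probability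
`x ch / ∑ ch', x ch'`. -/
def pick (x : Fin c → ℕ) (rnd : ℕ) : Option (Fin c) :=
  (List.finRange c).find? fun ch => rnd ≤ ∑ ch' ∈ Finset.Iic ch, x ch'

/-- The channel on which a listener listens in step `s` of part two, chosen with probabilities
proportional to the counts of part one (none if all counts are `0`). -/
noncomputable def listenChannel (ω : Tape c S) (h : ℕ → Option Id) (s : Fin S.steps₂) :
    Option (Fin c) :=
  if hpos : 0 < ∑ ch, counts ω h ch then
    pick (counts ω h) ((ω.draw₂ s ⟨∑ ch, counts ω h ch - 1, by
      have := sum_counts_le ω h; omega⟩ : ℕ) + 1)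
  else none

/-- Slot `j` of round `i` of step `s` of part one: the counting procedure on a uniformly random
channel in a uniformly random role. Broadcasters send with probability `1 / 2 ^ i` (`i` counts
from `0`). -/
def action₁ (id : Id) (ω : Tape c S) (s : Fin S.steps₁) (i : Fin S.rounds) (j : Fin S.roundLen) :
    RadioAction c Id :=
  if ω.role₁ s then
    if (ω.coin₁ s i j : ℕ) = 0 then .broadcast (ω.channel₁ s) id else .idle
  else .listen (ω.channel₁ s)

/-- Slot `j` of step `s` of part two. Broadcasters send on a uniformly random channel, with
probability `1 / 2 ^ rounds, …, 1 / 4, 1 / 2` in the successive slots of the step. -/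
noncomputable def action₂ (id : Id) (ω : Tape c S) (h : ℕ → Option Id) (s : Fin S.steps₂)
    (j : Fin S.rounds) : RadioAction c Id :=
  if ω.role₂ s then
    if (ω.coin₂ s j : ℕ) = 0 then .broadcast (ω.channel₂ s) id else .idle
  else
    match listenChannel ω h s with
    | some ch => .listen ch
    | none => .idle

/-- The action in slot `t`: part one, followed by part two. -/
noncomputable def action (id : Id) (ω : Tape c S) (t : ℕ) (h : ℕ → Option Id) : RadioAction c Id :=
  if h₁ : t < S.slots₁ then
    let p := finProdFinEquiv.symm (⟨t, h₁⟩ : Fin (S.steps₁ * (S.rounds * S.roundLen)))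
    let q := finProdFinEquiv.symm p.2
    action₁ id ω p.1 q.1 q.2
  else if h₂ : t - S.slots₁ < S.slots₂ then
    let p := finProdFinEquiv.symm (⟨t - S.slots₁, h₂⟩ : Fin (S.steps₂ * S.rounds))
    action₂ id ω h p.1 p.2
  else .idle

/-- The protocol; a node returns the set of all identities that it has heard. -/
noncomputable def protocol (Id : Type u) (c : ℕ) [NeZero c] (S : Shape) : Protocol Id c where
  Rand := Tape c S
  law := (PMF.uniformOfFintype (Tape c S)).toMeasure
  slots := S.slots₁ + S.slots₂
  action := action
  output _ _ h := {w | ∃ t, h t = some w}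

/-- The numerical data of CSeek. The counting procedure has `lg Δ` rounds of `Θ(lg n)` slots, part one
has `Θ((c² / k) lg n)` steps, part two has `Θ((kmax / k) Δ lg n)` steps of `lg Δ` slots. Non-integral
values are rounded up, and `lg Δ` is replaced by `1` if `Δ ≤ 1`. -/
noncomputable def shape (n c k kmax Δ : ℕ) (δ a C₁ C₂ : ℝ) : Shape where
  rounds := max 1 (Nat.clog 2 Δ)
  roundLen := ⌈a * lg n⌉₊
  steps₁ := ⌈C₁ * ((c : ℝ) ^ 2 / k * lg n)⌉₊
  steps₂ := ⌈C₂ * ((kmax : ℝ) / k * Δ * lg n)⌉₊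
  threshold := (1 + δ) * (8 * Real.exp (-7))

end CSeek

/-- CSeek for networks with `n` nodes, `c` channels per node, overlaps between `k` and `kmax`, and
degrees at most `Δ`. The constant `δ` belongs to the acceptance threshold of the counting procedure,
and `a`, `C₁`, `C₂` are the constants in its `Θ(·)`-terms. -/
noncomputable def cseek (Id : Type u) (n c k kmax Δ : ℕ) [NeZero c] (δ a C₁ C₂ : ℝ) :
    Protocol Id c :=
  CSeek.protocol Id c (CSeek.shape n c k kmax Δ δ a C₁ C₂)

/-! A node hears only neighbors, so the only failure is that some node x never hears some neighbor
w. A union bound over the n² ordered pairs (`one_sub_discoveryProb_le`) reduces the theorem to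
`pr_misses_le`, used with B = (α+4) lg n. Tapes are finite and uniform, so probabilities are finite
averages `pr`, and `tapesEquiv` sorts the draws by steps, which makes the steps independent.

Fix x and w. For a channel ℓ shared by them let d be the number of neighbors of x that can access ℓ,
and call ℓ crowded if d exceeds 32c. Of the at least k shared channels, at least k/2 are uncrowded
or at least k/2 are crowded.

Uncrowded channels are settled by part one. In the first round broadcasters always send, so x hears
w as soon as x listens on ℓ, w broadcasts there and the other neighbors do not. This has probability
of order 1/c² per channel (`pr_hears₁_ge`), hence k/c² per step, and (c²/k) lg n steps suffice.

Crowded channels are settled by part two, with part one as a density estimate. If m neighbors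
broadcast on the channel of x, the round with 2^i ≤ m ≤ 2^(i+1) is almost surely accepted, so the
expected count is at most 8m (`expect_stepCount_le`). Rounds with 64·2^i ≤ m are accepted with total
probability at most 1/8, so the count is at least of order m with constant probability
(`pr_stepCount_lt_le`). Over all steps, the total of a crowded channel is at least of order
`steps₁`·d/c² (`pr_total_small_le`), while the sum of all totals is at most of order
`steps₁`·kmax·Δ/c², because each neighbor appears on at most kmax channels (`pr_totals_large_le`).
So in part two x picks ℓ with probability at least of order d/(kmax·Δ). In the slot whose sending
probability fits d, it then hears w with probability of order 1/d (`pr_hears₂_one_ge`). The factor d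
cancels, and k/2 channels give order k/(kmax·Δ) per step. -/

open scoped BigOperators

namespace FinProb

open Finset

/-! ### Finite probability spaces with uniform distribution -/

open Classical in
/-- The indicator of a proposition. -/
noncomputable def ind (p : Prop) : ℝ := if p then 1 else 0

theorem ind_of {p : Prop} (h : p) : ind p = 1 := by simp [ind, h]

theorem ind_of_not {p : Prop} (h : ¬ p) : ind p = 0 := by simp [ind, h]

theorem ind_nonneg (p : Prop) : 0 ≤ ind p := by unfold ind; split_ifs <;> norm_num

theorem ind_le_one (p : Prop) : ind p ≤ 1 := by unfold ind; split_ifs <;> norm_num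

theorem ind_mono {p q : Prop} (h : p → q) : ind p ≤ ind q := by
  by_cases hp : p
  · rw [ind_of hp, ind_of (h hp)]
  · rw [ind_of_not hp]; exact ind_nonneg q

theorem ind_congr {p q : Prop} (h : p ↔ q) : ind p = ind q := by rw [propext h]

theorem ind_not (p : Prop) : ind (¬ p) = 1 - ind p := by
  by_cases hp : p
  · rw [ind_of hp, ind_of_not (not_not.mpr hp)]; norm_num
  · rw [ind_of_not hp, ind_of hp]; norm_num

theorem ind_and (p q : Prop) : ind (p ∧ q) = ind p * ind q := by
  by_cases hp : p <;> by_cases hq : q <;> simp [ind, hp, hq]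

theorem ind_or_le (p q : Prop) : ind (p ∨ q) ≤ ind p + ind q := by
  by_cases hp : p <;> by_cases hq : q <;> simp [ind, hp, hq]

theorem ind_forall_mem {ι : Type*} (S : Finset ι) (p : ι → Prop) :
    ind (∀ i ∈ S, p i) = ∏ i ∈ S, ind (p i) := by
  by_cases h : ∀ i ∈ S, p i
  · rw [ind_of h, Finset.prod_congr rfl fun i hi => ind_of (h i hi)]; simp
  · rw [ind_of_not h]
    push Not at h
    obtain ⟨i, hi, hp⟩ := h
    exact (Finset.prod_eq_zero hi (ind_of_not hp)).symm

theorem ind_forall {ι : Type*} [Fintype ι] (p : ι → Prop) :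
    ind (∀ i, p i) = ∏ i, ind (p i) := by
  rw [← ind_forall_mem]; simp

theorem ind_exists_mem_le {ι : Type*} (S : Finset ι) (p : ι → Prop) :
    ind (∃ i ∈ S, p i) ≤ ∑ i ∈ S, ind (p i) := by
  by_cases h : ∃ i ∈ S, p i
  · rw [ind_of h]
    obtain ⟨i, hi, hp⟩ := h
    rw [← ind_of hp]
    exact Finset.single_le_sum (f := fun i => ind (p i)) (fun i _ => ind_nonneg _) hi
  · rw [ind_of_not h]
    exact Finset.sum_nonneg fun i _ => ind_nonneg _

theorem ind_exists_mem_eq {ι : Type*} (S : Finset ι) (p : ι → Prop)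
    (hp : ∀ i ∈ S, ∀ j ∈ S, p i → p j → i = j) :
    ind (∃ i ∈ S, p i) = ∑ i ∈ S, ind (p i) := by
  by_cases h : ∃ i ∈ S, p i
  · rw [ind_of h]
    obtain ⟨i, hi, hpi⟩ := h
    rw [Finset.sum_eq_single i, ind_of hpi]
    · exact fun j hj hji => ind_of_not fun hpj => hji (hp j hj i hi hpj hpi)
    · exact fun h' => absurd hi h'
  · rw [ind_of_not h]
    push Not at h
    exact (Finset.sum_eq_zero fun i hi => ind_of_not (h i hi)).symm

theorem card_filter_eq_sum_ind {ι : Type*} (S : Finset ι) (p : ι → Prop) [DecidablePred p] :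
    ((S.filter p).card : ℝ) = ∑ i ∈ S, ind (p i) := by
  rw [Finset.card_filter]
  push_cast
  refine Finset.sum_congr rfl fun i _ => ?_
  by_cases h : p i <;> simp [ind, h]

section

variable {α β γ : Type*} [Fintype α] [Fintype β] [Fintype γ]

/-- The probability of an event under the uniform distribution. -/
noncomputable def pr (p : α → Prop) : ℝ := 𝔼 x, ind (p x)

theorem expect_mono {f g : α → ℝ} (h : ∀ x, f x ≤ g x) : 𝔼 x, f x ≤ 𝔼 x, g x :=
  Finset.expect_le_expect fun x _ => h x

theorem pr_nonneg (p : α → Prop) : 0 ≤ pr p := Finset.expect_nonneg fun _ _ => ind_nonneg _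

theorem pr_mono {p q : α → Prop} (h : ∀ x, p x → q x) : pr p ≤ pr q :=
  expect_mono fun x => ind_mono (h x)

theorem pr_congr {p q : α → Prop} (h : ∀ x, p x ↔ q x) : pr p = pr q :=
  Finset.expect_congr rfl fun x _ => ind_congr (h x)

theorem pr_le_one (p : α → Prop) : pr p ≤ 1 := by
  cases isEmpty_or_nonempty α
  · simp [pr]
  · exact Finset.expect_le univ_nonempty fun _ _ => ind_le_one _

theorem pr_false : pr (fun _ : α => False) = 0 :=
  Finset.expect_eq_zero fun _ _ => ind_of_not id

theorem pr_not [Nonempty α] (p : α → Prop) : pr (fun x => ¬ p x) = 1 - pr p := by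
  unfold pr
  simp_rw [ind_not]
  rw [Finset.expect_sub_distrib, Fintype.expect_one]

theorem pr_or_le (p q : α → Prop) : pr (fun x => p x ∨ q x) ≤ pr p + pr q := by
  unfold pr
  rw [← Finset.expect_add_distrib]
  exact expect_mono fun x => ind_or_le _ _

theorem pr_exists_mem_le {ι : Type*} (S : Finset ι) (p : ι → α → Prop) :
    pr (fun x => ∃ i ∈ S, p i x) ≤ ∑ i ∈ S, pr (p i) := by
  unfold pr
  rw [← Finset.expect_sum_comm]
  exact expect_mono fun x => ind_exists_mem_le _ _

theorem pr_exists_mem_eq {ι : Type*} (S : Finset ι) (p : ι → α → Prop)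
    (hp : ∀ x, ∀ i ∈ S, ∀ j ∈ S, p i x → p j x → i = j) :
    pr (fun x => ∃ i ∈ S, p i x) = ∑ i ∈ S, pr (p i) := by
  unfold pr
  rw [← Finset.expect_sum_comm]
  exact Finset.expect_congr rfl fun x _ => ind_exists_mem_eq _ _ (hp x)

/-- Markov's inequality. -/
theorem pr_le_expect (p : α → Prop) (f : α → ℝ) (h0 : ∀ x, 0 ≤ f x) (h1 : ∀ x, p x → 1 ≤ f x) :
    pr p ≤ 𝔼 x, f x := by
  refine expect_mono fun x => ?_
  by_cases hx : p x
  · rw [ind_of hx]; exact h1 x hx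
  · rw [ind_of_not hx]; exact h0 x

theorem expect_prod_type (f : α × β → ℝ) : 𝔼 x, f x = 𝔼 a, 𝔼 b, f (a, b) := by
  rw [← Finset.univ_product_univ, Finset.expect_product]

theorem pr_eq_one_div (a : α) : pr (fun x => x = a) = 1 / Fintype.card α := by
  classical
  unfold pr ind
  rw [Fintype.expect_eq_sum_div_card]
  simp

/-- Conditioning on the first component outside a bad event. -/
theorem pr_prod_le [Nonempty α] [Nonempty β] (bad : α → Prop) (q : α × β → Prop) {ε : ℝ}
    (hε : 0 ≤ ε) (h : ∀ a, ¬ bad a → pr (fun b => q (a, b)) ≤ ε) : pr q ≤ pr bad + ε := by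
  unfold pr
  rw [expect_prod_type, ← Fintype.expect_const (ι := α) ε, ← Finset.expect_add_distrib]
  refine expect_mono fun a => ?_
  by_cases ha : bad a
  · rw [ind_of ha]
    have := pr_le_one (fun b => q (a, b))
    unfold pr at this
    linarith
  · rw [ind_of_not ha, zero_add]
    exact h a ha

theorem expect_pi_prod {ι : Type*} [Fintype ι] [DecidableEq ι] {D : ι → Type*}
    [∀ i, Fintype (D i)] (g : ∀ i, D i → ℝ) :
    𝔼 x : ∀ i, D i, ∏ i, g i (x i) = ∏ i, 𝔼 y, g i y := by
  simp_rw [Fintype.expect_eq_sum_div_card]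
  rw [Finset.prod_div_distrib, Fintype.card_pi, Nat.cast_prod, Finset.prod_univ_sum,
    Fintype.piFinset_univ]

theorem pr_pi {ι : Type*} [Fintype ι] [DecidableEq ι] {D : ι → Type*}
    [∀ i, Fintype (D i)] (p : ∀ i, D i → Prop) :
    pr (fun x : ∀ i, D i => ∀ i, p i (x i)) = ∏ i, pr (p i) := by
  unfold pr
  rw [← expect_pi_prod]
  exact Finset.expect_congr rfl fun x _ => ind_forall _

theorem pr_prod (p : α → Prop) (q : β → Prop) :
    pr (fun x : α × β => p x.1 ∧ q x.2) = pr p * pr q := by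
  unfold pr
  rw [expect_prod_type, Finset.expect_mul]
  refine Finset.expect_congr rfl fun a _ => ?_
  rw [Finset.mul_expect]
  exact Finset.expect_congr rfl fun b _ => ind_and _ _

/-- A map under which the uniform distribution is pushed to the uniform distribution. -/
def Balanced (π : α → β) : Prop := ∀ g : β → ℝ, 𝔼 x, g (π x) = 𝔼 y, g y

theorem Balanced.pr {π : α → β} (h : Balanced π) (p : β → Prop) :
    FinProb.pr (fun x => p (π x)) = FinProb.pr p := h fun y => ind (p y)

theorem Balanced.comp {π : α → β} {ρ : β → γ} (hρ : Balanced ρ) (hπ : Balanced π) :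
    Balanced fun x => ρ (π x) := fun g => (hπ fun y => g (ρ y)).trans (hρ g)

theorem Balanced.equiv (e : α ≃ β) : Balanced e := fun _ => Fintype.expect_equiv e _ _ fun _ => rfl

theorem Balanced.fst [Nonempty β] : Balanced (Prod.fst : α × β → α) := fun g => by
  rw [expect_prod_type]
  exact Finset.expect_congr rfl fun a _ => Fintype.expect_const (g a)

theorem Balanced.snd [Nonempty α] : Balanced (Prod.snd : α × β → β) := fun g => by
  rw [expect_prod_type]
  exact Fintype.expect_const (ι := α) (𝔼 b, g b)

/-- Balanced maps are determined by the probabilities of points. -/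
theorem Balanced.of_pr {π : α → β}
    (h : ∀ b, FinProb.pr (fun x => π x = b) = FinProb.pr (fun y => y = b)) : Balanced π := by
  classical
  intro g
  have key : ∀ y, g y = ∑ b, g b * ind (y = b) := fun y => by
    rw [Finset.sum_eq_single y]
    · rw [ind_of rfl, mul_one]
    · exact fun b _ hb => by rw [ind_of_not (Ne.symm hb), mul_zero]
    · exact fun h' => absurd (mem_univ _) h'
  calc 𝔼 x, g (π x) = 𝔼 x, ∑ b, g b * ind (π x = b) :=
        Finset.expect_congr rfl fun x _ => key _
    _ = ∑ b, g b * FinProb.pr (fun x => π x = b) := by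
        rw [Finset.expect_sum_comm]
        exact Finset.sum_congr rfl fun b _ => (Finset.mul_expect _ _ _).symm
    _ = ∑ b, g b * FinProb.pr (fun y => y = b) := by simp_rw [h]
    _ = 𝔼 y, ∑ b, g b * ind (y = b) := by
        rw [Finset.expect_sum_comm]
        exact Finset.sum_congr rfl fun b _ => (Finset.mul_expect _ _ _)
    _ = 𝔼 y, g y := (Finset.expect_congr rfl fun x _ => key _).symm

theorem Balanced.pi {ι : Type*} [Fintype ι] [DecidableEq ι] {D E : ι → Type*}
    [∀ i, Fintype (D i)] [∀ i, Fintype (E i)] {π : ∀ i, D i → E i} (h : ∀ i, Balanced (π i)) :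
    Balanced fun (x : ∀ i, D i) i => π i (x i) := by
  refine Balanced.of_pr fun b => ?_
  simp_rw [funext_iff]
  rw [pr_pi fun i x => π i x = b i, pr_pi fun i y => y = b i]
  exact Finset.prod_congr rfl fun i _ => (h i).pr fun y => y = b i

theorem Balanced.eval {ι : Type*} [Fintype ι] [DecidableEq ι] {D : ι → Type*}
    [∀ i, Fintype (D i)] [∀ i, Nonempty (D i)] (i : ι) :
    Balanced fun x : ∀ i, D i => x i := by
  refine Balanced.of_pr fun b => ?_
  -- The event at coordinate `i` becomes a condition on every coordinate, void away from `i`, so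
  -- that `pr_pi` applies despite the dependent types.
  let q : ∀ j, D j → Prop := fun j y => ∀ h : j = i, y = h.symm ▸ b
  have h1 : FinProb.pr (fun x : ∀ i, D i => x i = b) =
      FinProb.pr (fun x : ∀ i, D i => ∀ j, q j (x j)) := by
    refine pr_congr fun x => ⟨?_, fun h => h i rfl⟩
    rintro rfl j rfl
    rfl
  rw [h1, pr_pi q, Finset.prod_eq_single i]
  · exact pr_congr fun y => ⟨fun h => h rfl, fun h _ => h⟩
  · intro j _ hj
    rw [← Fintype.expect_one (ι := D j) (M := ℝ)]
    exact Finset.expect_congr rfl fun y _ => ind_of fun h => absurd h hj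
  · exact fun h' => absurd (mem_univ _) h'

/-! ### Tail bounds -/

/-- Since e > 2, an occurrence of `E` at least halves the exponential; 1 - p/2 ≤ exp(-p/2) does the
rest. -/
theorem expect_exp_neg_ind_le [Nonempty α] (E : α → Prop) {p : ℝ} (hp : p ≤ pr E) :
    𝔼 x, Real.exp (-ind (E x)) ≤ Real.exp (-(p / 2)) := by
  have h1 : ∀ x, Real.exp (-ind (E x)) ≤ 1 - 1 / 2 * ind (E x) := fun x => by
    by_cases hx : E x
    · rw [ind_of hx]
      have := Real.exp_one_gt_d9
      rw [Real.exp_neg, inv_le_comm₀ (Real.exp_pos _) (by norm_num)]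
      norm_num
      linarith
    · rw [ind_of_not hx]; simp
  have h2 : 𝔼 x, Real.exp (-ind (E x)) ≤ 1 - 1 / 2 * pr E := by
    refine (expect_mono h1).trans_eq ?_
    rw [Finset.expect_sub_distrib, Fintype.expect_one, ← Finset.mul_expect, pr]
  have := Real.add_one_le_exp (-(p / 2))
  linarith

/-- A lower tail bound for the number of the events `E i` that happen, jointly with independent
events `A i` on the other coordinates. -/
theorem pr_lower_tail {ι : Type*} [Fintype ι] [DecidableEq ι] [Nonempty α] (S : Finset ι)
    (A E : ι → α → Prop) {p : ℝ} (hp : ∀ i ∈ S, p ≤ pr (E i)) :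
    pr (fun x : ι → α => (∀ i ∈ Sᶜ, A i (x i)) ∧ ∑ i ∈ S, ind (E i (x i)) ≤ p * S.card / 4) ≤
      (∏ i ∈ Sᶜ, pr (A i)) * Real.exp (-(p * S.card / 4)) := by
  -- Exponential Markov inequality with parameter 1. The indicators of `A` are extra factors, so a
  -- single product over independent coordinates bounds the joint event.
  set g : ι → α → ℝ := fun i y => if i ∈ S then Real.exp (-ind (E i y)) else ind (A i y) with hg
  have hg0 : ∀ i y, 0 ≤ g i y := fun i y => by
    simp only [hg]; split_ifs
    · exact (Real.exp_pos _).le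
    · exact ind_nonneg _
  have hsplit : ∀ f : ι → ℝ, ∏ i, f i = (∏ i ∈ Sᶜ, f i) * ∏ i ∈ S, f i := fun f => by
    rw [mul_comm, Finset.prod_mul_prod_compl]
  have hc : ∀ i ∈ Sᶜ, ∀ y, g i y = ind (A i y) := fun i hi y => by
    simp only [hg, if_neg (Finset.mem_compl.mp hi)]
  have hS : ∀ i ∈ S, ∀ y, g i y = Real.exp (-ind (E i y)) := fun i hi y => by
    simp only [hg, if_pos hi]
  have h1 : pr (fun x : ι → α => (∀ i ∈ Sᶜ, A i (x i)) ∧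
      ∑ i ∈ S, ind (E i (x i)) ≤ p * S.card / 4) ≤
      𝔼 x : ι → α, Real.exp (p * S.card / 4) * ∏ i, g i (x i) := by
    refine pr_le_expect _ _ (fun x => mul_nonneg (Real.exp_pos _).le
      (Finset.prod_nonneg fun i _ => hg0 _ _)) fun x hx => ?_
    rw [hsplit, Finset.prod_congr rfl fun i hi => (hc i hi (x i)).trans (ind_of (hx.1 i hi)),
      Finset.prod_congr rfl fun i hi => hS i hi (x i), Finset.prod_const_one, one_mul,
      ← Real.exp_sum, ← Real.exp_add]
    refine Real.one_le_exp ?_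
    rw [Finset.sum_neg_distrib]
    linarith [hx.2]
  refine h1.trans ?_
  rw [← Finset.mul_expect, expect_pi_prod, hsplit]
  have h2 : ∏ i ∈ Sᶜ, 𝔼 y, g i y = ∏ i ∈ Sᶜ, pr (A i) :=
    Finset.prod_congr rfl fun i hi => Finset.expect_congr rfl fun y _ => hc i hi y
  have h3 : ∏ i ∈ S, 𝔼 y, g i y ≤ Real.exp (-(p * S.card / 2)) := by
    calc ∏ i ∈ S, 𝔼 y, g i y ≤ ∏ _i ∈ S, Real.exp (-(p / 2)) := by
          refine Finset.prod_le_prod (fun i _ => Finset.expect_nonneg fun y _ => hg0 _ _)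
            fun i hi => ?_
          rw [Finset.expect_congr rfl fun y _ => hS i hi y]
          exact expect_exp_neg_ind_le _ (hp i hi)
      _ = Real.exp (-(p * S.card / 2)) := by
          rw [Finset.prod_const, ← Real.exp_nat_mul]
          congr 1; ring
  rw [h2, mul_left_comm]
  refine mul_le_mul_of_nonneg_left ?_ (Finset.prod_nonneg fun i _ => pr_nonneg _)
  calc _ ≤ Real.exp (p * S.card / 4) * Real.exp (-(p * S.card / 2)) :=
        mul_le_mul_of_nonneg_left h3 (Real.exp_pos _).le
    _ = _ := by rw [← Real.exp_add]; congr 1; ring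

theorem pr_lower_tail_univ {ι : Type*} [Fintype ι] [DecidableEq ι] [Nonempty α]
    (E : α → Prop) {p : ℝ} (hp : p ≤ pr E) :
    pr (fun x : ι → α => ∑ i, ind (E (x i)) ≤ p * Fintype.card ι / 4) ≤
      Real.exp (-(p * Fintype.card ι / 4)) := by
  have := pr_lower_tail (Finset.univ : Finset ι) (fun _ _ => True) (fun _ => E) (p := p)
    fun _ _ => hp
  simpa [Finset.card_univ] using this

/-- Chernoff bound with parameter 1: by convexity exp y ≤ 1 + (e-1)y ≤ 1 + 2y on [0,1], so each
factor has mean at most exp(2μ), against the exponent 3μ of the threshold. -/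
theorem pr_upper_tail {ι : Type*} [Fintype ι] [DecidableEq ι] [Nonempty α] (Y : α → ℝ)
    (h0 : ∀ y, 0 ≤ Y y) (h1 : ∀ y, Y y ≤ 1) {μ : ℝ} (hμ : 𝔼 y, Y y ≤ μ) :
    pr (fun x : ι → α => 3 * (μ * Fintype.card ι) ≤ ∑ i, Y (x i)) ≤
      Real.exp (-(μ * Fintype.card ι)) := by
  have hb : ∀ y, Real.exp (Y y) ≤ 1 + 2 * Y y := fun y => by
    have hc := convexOn_exp.2 (Set.mem_univ 0) (Set.mem_univ 1) (sub_nonneg.mpr (h1 y)) (h0 y)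
      (by ring)
    simp only [smul_eq_mul, mul_zero, mul_one, zero_add, Real.exp_zero] at hc
    have := Real.exp_one_lt_d9
    have h3 : Y y * Real.exp 1 ≤ Y y * 3 := mul_le_mul_of_nonneg_left (by linarith) (h0 y)
    linarith
  have hm : 𝔼 y, Real.exp (Y y) ≤ Real.exp (2 * μ) := by
    have : 𝔼 y, Real.exp (Y y) ≤ 1 + 2 * 𝔼 y, Y y := by
      refine (expect_mono hb).trans_eq ?_
      rw [Finset.expect_add_distrib, Fintype.expect_one, ← Finset.mul_expect]
    have h' := Real.add_one_le_exp (2 * μ)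
    linarith
  calc _ ≤ 𝔼 x : ι → α, Real.exp (-(3 * (μ * Fintype.card ι))) * ∏ i, Real.exp (Y (x i)) := by
        refine pr_le_expect _ _ (fun x => mul_nonneg (Real.exp_pos _).le
          (Finset.prod_nonneg fun i _ => (Real.exp_pos _).le)) fun x hx => ?_
        rw [← Real.exp_sum, ← Real.exp_add]
        exact Real.one_le_exp (by linarith)
    _ = Real.exp (-(3 * (μ * Fintype.card ι))) * (𝔼 y, Real.exp (Y y)) ^ Fintype.card ι := by
        rw [← Finset.mul_expect, expect_pi_prod fun (_ : ι) y => Real.exp (Y y), Finset.prod_const,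
          Finset.card_univ]
    _ ≤ Real.exp (-(3 * (μ * Fintype.card ι))) * Real.exp (2 * μ) ^ Fintype.card ι := by
        gcongr
    _ = _ := by
        rw [← Real.exp_nat_mul, ← Real.exp_add]; congr 1; ring

theorem pr_forall_not_le {ι : Type*} [Fintype ι] [DecidableEq ι] [Nonempty α] (E : α → Prop)
    {p : ℝ} (hp : p ≤ pr E) :
    pr (fun x : ι → α => ∀ i, ¬ E (x i)) ≤ Real.exp (-(p * Fintype.card ι)) := by
  rw [pr_pi fun (_ : ι) y => ¬ E y, Finset.prod_const, Finset.card_univ, pr_not]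
  calc (1 - pr E) ^ Fintype.card ι ≤ Real.exp (-p) ^ Fintype.card ι := by
        refine pow_le_pow_left₀ (by linarith [pr_le_one E]) ?_ _
        have := Real.add_one_le_exp (-p)
        linarith
    _ = _ := by rw [← Real.exp_nat_mul]; congr 1; ring

end

end FinProb

/-! ### The execution of CSeek in terms of the draws of the single steps -/

/-- As every message is the identity of its sender, uniqueness of the pair (sender, message) is
uniqueness of the sender: the neighbors broadcasting on the channel form the set {w}. -/
theorem CRNetwork.received_eq_some_iff {V : Type u} {Ch : Type v} {c : ℕ} (N : CRNetwork V Ch c)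
    {acts : V → RadioAction c V} (hid : ∀ w e m, acts w = .broadcast e m → m = w) (u w : V) :
    N.received acts u = some w ↔ ∃ ℓ, acts u = .listen ℓ ∧ ∀ w', (N.graph.Adj u w' ∧
      ∃ e, acts w' = .broadcast e w' ∧ N.channel w' e = N.channel u ℓ) ↔ w' = w := by
  unfold CRNetwork.received
  cases hu : acts u with
  | broadcast e m => simp
  | idle => simp
  | listen ℓ =>
    simp only [RadioAction.listen.injEq, exists_eq_left']
    split_ifs with h
    · have hspec := h.exists.choose_spec
      have huniq : ∀ q, _ → q = h.exists.choose := fun q hq => h.unique hq hspec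
      obtain ⟨hadj, e, he, hch⟩ := hspec
      have h2 : h.exists.choose.2 = h.exists.choose.1 := hid _ _ _ he
      constructor
      · rintro hw
        have hw := Option.some.inj hw
        intro w'
        constructor
        · rintro ⟨h1, e', he', hch'⟩
          have := huniq (w', w') ⟨h1, e', he', hch'⟩
          rw [← hw, ← this]
        · rintro rfl
          rw [← hw, h2]
          rw [h2] at he
          exact ⟨hadj, e, he, hch⟩
      · intro hw
        rw [h2] at he
        rw [h2, (hw _).mp ⟨hadj, e, he, hch⟩]
    · constructor
      · intro h'; cases h'
      · intro hw
        refine absurd ?_ h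
        obtain ⟨h1, e, he, hch⟩ := (hw w).mpr rfl
        refine ⟨(w, w), ⟨h1, e, he, hch⟩, ?_⟩
        rintro ⟨w', m⟩ ⟨h1', e', he', hch'⟩
        have : m = w' := hid _ _ _ he'
        subst this
        rw [(hw m).mp ⟨h1', e', he', hch'⟩]

theorem Protocol.history_apply {V : Type u} {Ch : Type v} {c : ℕ} (P : Protocol V c)
    (N : CRNetwork V Ch c) (ω : V → P.Rand) (t : ℕ) (w : V) (τ : ℕ) :
    P.history N ω t w τ = if τ < t then
      N.received (fun v => P.action v (ω v) τ (P.history N ω τ v)) w else none := by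
  induction t with
  | zero => simp [Protocol.history]
  | succ t ih =>
    simp only [Protocol.history, Function.update_apply]
    split_ifs with h1 h2 h2
    · rw [h1]
    · omega
    · rw [ih, if_pos (by omega)]
    · rw [ih, if_neg (by omega)]

theorem Protocol.history_eq_some_iff {V : Type u} {Ch : Type v} {c : ℕ} (P : Protocol V c)
    (N : CRNetwork V Ch c)
    (hid : ∀ w r t h e m, P.action w r t h = .broadcast e m → m = w)
    (ω : V → P.Rand) (t : ℕ) (x w : V) (τ : ℕ) :
    P.history N ω t x τ = some w ↔ τ < t ∧
      ∃ ℓ, P.action x (ω x) τ (P.history N ω τ x) = .listen ℓ ∧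
        ∀ w', (N.graph.Adj x w' ∧ ∃ e, P.action w' (ω w') τ (P.history N ω τ w') =
          .broadcast e w' ∧ N.channel w' e = N.channel x ℓ) ↔ w' = w := by
  rw [Protocol.history_apply]
  split_ifs with h
  · rw [CRNetwork.received_eq_some_iff N fun w e m => hid _ _ _ _ _ _]
    simp only [h, true_and]
  · simp [h]

namespace CSeek

/-- The draws of one node in one step of part one: channel and role, and the coins. -/
abbrev Draw₁ (c : ℕ) (S : Shape) : Type :=
  (Fin c × Bool) × ((i : Fin S.rounds) → Fin S.roundLen → Fin (2 ^ (i : ℕ)))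

/-- The draws of one node in one step of part two: role and channel, the coins, and the draws for
the choice of a channel to listen on. -/
abbrev Draw₂ (c : ℕ) (S : Shape) : Type :=
  (Bool × Fin c) × ((j : Fin S.rounds) → Fin (2 ^ (S.rounds - (j : ℕ)))) ×
    ((i : Fin S.maxTotal) → Fin ((i : ℕ) + 1))

/-- The tapes of all nodes, sorted by steps. -/
def tapesEquiv (V : Type u) (c : ℕ) (S : Shape) : (V → Tape c S) ≃
    (Fin S.steps₁ → V → Draw₁ c S) × (Fin S.steps₂ → V → Draw₂ c S) where
  toFun ω := (fun s w => (((ω w).channel₁ s, (ω w).role₁ s), (ω w).coin₁ s),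
    fun s w => (((ω w).role₂ s, (ω w).channel₂ s), (ω w).coin₂ s, (ω w).draw₂ s))
  invFun y w := ⟨fun s => (y.1 s w).1.1, fun s => (y.1 s w).1.2, fun s => (y.1 s w).2,
    fun s => (y.2 s w).1.1, fun s => (y.2 s w).1.2, fun s => (y.2 s w).2.1,
    fun s => (y.2 s w).2.2⟩
  left_inv _ := rfl
  right_inv _ := rfl

variable {V : Type u} {Ch : Type v} {c : ℕ} {S : Shape} (N : CRNetwork V Ch c)

/-- The neighbors of `x` that are broadcasters on the channel of `x` in a step of part one with the
channels and roles `z`. -/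
def speakers (x : V) (z : V → Fin c × Bool) : Set V :=
  {w | N.graph.Adj x w ∧ (z w).2 = true ∧ N.channel w (z w).1 = N.channel x (z x).1}

/-- Node `x` hears `w` in slot `j` of round `i` of a step of part one with the draws `y`. -/
def Hears₁ (x : V) (y : V → Draw₁ c S) (i : Fin S.rounds) (j : Fin S.roundLen) (w : V) : Prop :=
  (y x).1.2 = false ∧
    ∀ w', (w' ∈ speakers N x (fun v => (y v).1) ∧ ((y w').2 i j : ℕ) = 0) ↔ w' = w

open Classical in
/-- Node `x` accepts round `i` of a step of part one with the draws `y`. -/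
def StepAccepts (x : V) (y : V → Draw₁ c S) (i : Fin S.rounds) : Prop :=
  S.threshold * S.roundLen <
    (Finset.univ.filter fun j : Fin S.roundLen => ∃ w, Hears₁ N x y i j w).card

open Classical in
/-- The count obtained by `x` in a step of part one with the draws `y`. -/
noncomputable def stepCount (x : V) (y : V → Draw₁ c S) : ℕ :=
  ∑ i : Fin S.rounds, if StepAccepts N x y i ∧ ∀ i' < i, ¬ StepAccepts N x y i'
    then 2 ^ ((i : ℕ) + 2) else 0

/-- The totals of `x` after part one with the draws `y`. -/
noncomputable def totals (x : V) (y : Fin S.steps₁ → V → Draw₁ c S) (ℓ : Fin c) : ℕ :=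
  ∑ s : Fin S.steps₁, if (y s x).1.1 = ℓ then stepCount N x (y s) else 0

theorem StepAccepts.exists_hears {x : V} {y : V → Draw₁ c S} {i : Fin S.rounds}
    (hthr : 0 < S.threshold) (h : StepAccepts N x y i) : ∃ j w, Hears₁ N x y i j w := by
  classical
  have h0 : 0 ≤ S.threshold * S.roundLen := by positivity
  have hpos := lt_of_le_of_lt h0 h
  rw [Nat.cast_pos, Finset.card_pos] at hpos
  obtain ⟨j, hj⟩ := hpos
  exact ⟨j, (Finset.mem_filter.mp hj).2⟩

/-- At most one round is the first accepted one, so the defining sum has at most one nonzero term.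
-/
theorem stepCount_cases (x : V) (y : V → Draw₁ c S) :
    (∃ i, StepAccepts N x y i ∧ (∀ i' < i, ¬ StepAccepts N x y i') ∧
      stepCount N x y = 2 ^ ((i : ℕ) + 2)) ∨
    ((∀ i, ¬ StepAccepts N x y i) ∧ stepCount N x y = 0) := by
  classical
  by_cases hex : ∃ i, StepAccepts N x y i ∧ ∀ i' < i, ¬ StepAccepts N x y i'
  · obtain ⟨i, hi⟩ := hex
    refine Or.inl ⟨i, hi.1, hi.2, ?_⟩
    unfold stepCount
    rw [Finset.sum_eq_single i, if_pos hi]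
    · intro b _ hb
      rw [if_neg]
      rintro ⟨h1, h2⟩
      rcases lt_or_gt_of_ne hb with hlt | hgt
      · exact hi.2 b hlt h1
      · exact h2 i hgt hi.1
    · simp
  · refine Or.inr ⟨fun i hi => ?_, ?_⟩
    · refine hex ?_
      obtain ⟨i₀, h1, h2⟩ := WellFounded.has_min (wellFounded_lt (α := Fin S.rounds))
        {i | StepAccepts N x y i} ⟨i, hi⟩
      exact ⟨i₀, h1, fun i' hi' h => h2 i' h hi'⟩
    · unfold stepCount
      exact Finset.sum_eq_zero fun i _ => if_neg fun h => hex ⟨i, h⟩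

theorem stepCount_le (x : V) (y : V → Draw₁ c S) : stepCount N x y ≤ 2 ^ (S.rounds + 1) := by
  rcases stepCount_cases N x y with ⟨i, -, -, h⟩ | ⟨-, h⟩
  · rw [h]
    exact Nat.pow_le_pow_right (by norm_num) (by have := i.isLt; omega)
  · rw [h]; positivity

theorem stepCount_le_of_accepts {x : V} {y : V → Draw₁ c S} {i : Fin S.rounds}
    (h : StepAccepts N x y i) : stepCount N x y ≤ 2 ^ ((i : ℕ) + 2) := by
  rcases stepCount_cases N x y with ⟨i₀, -, h2, h3⟩ | ⟨h1, -⟩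
  · rw [h3]
    have : i₀ ≤ i := not_lt.mp fun hlt => h2 i hlt h
    exact Nat.pow_le_pow_right (by norm_num) (by have : (i₀ : ℕ) ≤ i := this; omega)
  · exact absurd h (h1 i)

theorem sum_totals (x : V) (y : Fin S.steps₁ → V → Draw₁ c S) :
    ∑ ℓ, totals N x y ℓ = ∑ s, stepCount N x (y s) := by
  unfold totals
  rw [Finset.sum_comm]
  simp

theorem sum_totals_le (x : V) (y : Fin S.steps₁ → V → Draw₁ c S) :
    ∑ ℓ, totals N x y ℓ ≤ S.maxTotal := by
  rw [sum_totals]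
  exact (Finset.sum_le_sum fun s _ => stepCount_le N x _).trans (by simp [Shape.maxTotal])

/-- The channel that a listener with the totals `X` chooses in a step of part two. -/
def chosen (X : Fin c → ℕ) (d : (i : Fin S.maxTotal) → Fin ((i : ℕ) + 1)) : Option (Fin c) :=
  if h : 0 < ∑ ℓ, X ℓ ∧ ∑ ℓ, X ℓ ≤ S.maxTotal then
    pick X ((d ⟨∑ ℓ, X ℓ - 1, by omega⟩ : ℕ) + 1)
  else none

/-- Node `x`, with the totals `X`, hears `w` on channel `ℓ` in slot `j` of a step of part two with
the draws `y`. -/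
def Hears₂ (x : V) (X : Fin c → ℕ) (y : V → Draw₂ c S) (ℓ : Fin c) (j : Fin S.rounds) (w : V) :
    Prop :=
  ((y x).1.1 = false ∧ chosen X (y x).2.2 = some ℓ) ∧
    ∀ w', (N.graph.Adj x w' ∧ ((y w').1.1 = true ∧ N.channel w' (y w').1.2 = N.channel x ℓ) ∧
      ((y w').2.1 j : ℕ) = 0) ↔ w' = w

theorem slot₁_lt (s : Fin S.steps₁) (i : Fin S.rounds) (j : Fin S.roundLen) :
    slot₁ s i j < S.slots₁ := (finProdFinEquiv (s, finProdFinEquiv (i, j))).isLt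

theorem action_slot₁ (w : V) (ω : Tape c S) (s : Fin S.steps₁) (i : Fin S.rounds)
    (j : Fin S.roundLen) (h : ℕ → Option V) :
    action w ω (slot₁ s i j) h = action₁ w ω s i j := by
  unfold action
  rw [dif_pos (slot₁_lt s i j)]
  have : (⟨slot₁ s i j, slot₁_lt s i j⟩ : Fin (S.steps₁ * (S.rounds * S.roundLen))) =
      finProdFinEquiv (s, finProdFinEquiv (i, j)) := rfl
  simp only [this, Equiv.symm_apply_apply]

theorem action_slot₂ (w : V) (ω : Tape c S) (s : Fin S.steps₂) (j : Fin S.rounds)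
    (h : ℕ → Option V) :
    action w ω (S.slots₁ + (finProdFinEquiv (s, j) : ℕ)) h = action₂ w ω h s j := by
  have hlt : (finProdFinEquiv (s, j) : ℕ) < S.slots₂ := (finProdFinEquiv (s, j)).isLt
  unfold action
  rw [dif_neg (by omega), dif_pos (by omega)]
  have : (⟨S.slots₁ + (finProdFinEquiv (s, j) : ℕ) - S.slots₁, by omega⟩ :
      Fin (S.steps₂ * S.rounds)) = finProdFinEquiv (s, j) := Fin.ext (by simp)
  simp only [this, Equiv.symm_apply_apply]

theorem action₁_eq_broadcast_iff (w : V) (ω : Tape c S) (s : Fin S.steps₁) (i : Fin S.rounds)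
    (j : Fin S.roundLen) (e : Fin c) (m : V) : action₁ w ω s i j = .broadcast e m ↔
      (ω.role₁ s = true ∧ (ω.coin₁ s i j : ℕ) = 0) ∧ ω.channel₁ s = e ∧ w = m := by
  unfold action₁
  split_ifs with h1 h2 <;> simp_all

theorem action₁_eq_listen_iff (w : V) (ω : Tape c S) (s : Fin S.steps₁) (i : Fin S.rounds)
    (j : Fin S.roundLen) (e : Fin c) : action₁ w ω s i j = .listen e ↔
      ω.role₁ s = false ∧ ω.channel₁ s = e := by
  unfold action₁
  split_ifs with h1 h2 <;> simp_all

theorem action₂_eq_broadcast_iff (w : V) (ω : Tape c S) (h : ℕ → Option V) (s : Fin S.steps₂)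
    (j : Fin S.rounds) (e : Fin c) (m : V) : action₂ w ω h s j = .broadcast e m ↔
      (ω.role₂ s = true ∧ (ω.coin₂ s j : ℕ) = 0) ∧ ω.channel₂ s = e ∧ w = m := by
  unfold action₂
  split_ifs with h1 h2
  · simp_all
  · simp_all
  · cases listenChannel ω h s <;> simp_all

theorem action₂_eq_listen_iff (w : V) (ω : Tape c S) (h : ℕ → Option V) (s : Fin S.steps₂)
    (j : Fin S.rounds) (e : Fin c) : action₂ w ω h s j = .listen e ↔
      ω.role₂ s = false ∧ listenChannel ω h s = some e := by
  unfold action₂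
  split_ifs with h1 h2
  · simp_all
  · simp_all
  · cases listenChannel ω h s <;> simp_all

theorem action_eq_broadcast {w : V} {ω : Tape c S} {t : ℕ} {h : ℕ → Option V} {e : Fin c} {m : V}
    (ha : action w ω t h = .broadcast e m) : m = w := by
  unfold action at ha
  split_ifs at ha
  · exact ((action₁_eq_broadcast_iff ..).mp ha).2.2.symm
  · exact ((action₂_eq_broadcast_iff ..).mp ha).2.2.symm

variable [NeZero c]

theorem history_eq_some_iff (ω : V → Tape c S) (t : ℕ) (x w : V) (τ : ℕ) :
    (protocol V c S).history N ω t x τ = some w ↔ τ < t ∧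
      ∃ ℓ, action x (ω x) τ ((protocol V c S).history N ω τ x) = .listen ℓ ∧
        ∀ w', (N.graph.Adj x w' ∧ ∃ e,
          action w' (ω w') τ ((protocol V c S).history N ω τ w') = .broadcast e w' ∧
            N.channel w' e = N.channel x ℓ) ↔ w' = w :=
  Protocol.history_eq_some_iff (protocol V c S) N
    (fun _ _ _ _ _ _ => action_eq_broadcast) ω t x w τ

theorem adj_of_history {ω : V → Tape c S} {t : ℕ} {x w : V} {τ : ℕ}
    (h : (protocol V c S).history N ω t x τ = some w) : N.graph.Adj x w := by
  obtain ⟨-, ℓ, -, h2⟩ := (history_eq_some_iff N ω t x w τ).mp h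
  exact ((h2 w).mpr rfl).1

/-- Part one is not adaptive: what is heard in a step depends on the draws of that step alone. Any
later time `t` is allowed because part two consults the record while it grows. -/
theorem history_slot₁_eq_some_iff (ω : V → Tape c S) {t : ℕ} (ht : S.slots₁ ≤ t) (x w : V)
    (s : Fin S.steps₁) (i : Fin S.rounds) (j : Fin S.roundLen) :
    (protocol V c S).history N ω t x (slot₁ s i j) = some w ↔
      Hears₁ N x ((tapesEquiv V c S ω).1 s) i j w := by
  rw [history_eq_some_iff]
  simp only [action_slot₁, action₁_eq_listen_iff, action₁_eq_broadcast_iff, Hears₁, speakers,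
    tapesEquiv, Equiv.coe_fn_mk, Set.mem_ofPred_eq, (slot₁_lt s i j).trans_le ht, true_and]
  constructor
  · rintro ⟨ℓ, ⟨h1, rfl⟩, h3⟩
    refine ⟨h1, fun w' => ?_⟩
    rw [← h3 w']
    constructor
    · rintro ⟨⟨h4, h5, h6⟩, h7⟩
      exact ⟨h4, _, ⟨⟨h5, h7⟩, rfl, trivial⟩, h6⟩
    · rintro ⟨h4, _, ⟨⟨h5, h7⟩, rfl, -⟩, h6⟩
      exact ⟨⟨h4, h5, h6⟩, h7⟩
  · rintro ⟨h1, h3⟩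
    refine ⟨_, ⟨h1, rfl⟩, fun w' => ?_⟩
    rw [← h3 w']
    constructor
    · rintro ⟨h4, _, ⟨⟨h5, h7⟩, rfl, -⟩, h6⟩
      exact ⟨⟨h4, h5, h6⟩, h7⟩
    · rintro ⟨⟨h4, h5, h6⟩, h7⟩
      exact ⟨h4, _, ⟨⟨h5, h7⟩, rfl, trivial⟩, h6⟩

theorem accepts_history_iff (ω : V → Tape c S) {t : ℕ} (ht : S.slots₁ ≤ t) (x : V)
    (s : Fin S.steps₁) (i : Fin S.rounds) :
    Accepts ((protocol V c S).history N ω t x) s i ↔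
      StepAccepts N x ((tapesEquiv V c S ω).1 s) i := by
  classical
  unfold Accepts StepAccepts heard
  simp_rw [Option.isSome_iff_exists, history_slot₁_eq_some_iff N ω ht]

theorem counts_history (ω : V → Tape c S) {t : ℕ} (ht : S.slots₁ ≤ t) (x : V) :
    counts (ω x) ((protocol V c S).history N ω t x) = totals N x (tapesEquiv V c S ω).1 := by
  classical
  funext ℓ
  unfold counts totals count stepCount
  simp only [accepts_history_iff N ω ht]
  refine Finset.sum_congr rfl fun s _ => ?_
  simp only [tapesEquiv, Equiv.coe_fn_mk]
  congr!

/-- Part one enters part two only through the totals. Once the draws of part one are fixed, the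
steps of part two are independent and identically distributed. -/
theorem listenChannel_history (ω : V → Tape c S) {t : ℕ} (ht : S.slots₁ ≤ t) (x : V)
    (s : Fin S.steps₂) :
    listenChannel (ω x) ((protocol V c S).history N ω t x) s =
      chosen (totals N x (tapesEquiv V c S ω).1) ((tapesEquiv V c S ω).2 s x).2.2 := by
  have h : listenChannel (ω x) ((protocol V c S).history N ω t x) s =
      chosen (counts (ω x) ((protocol V c S).history N ω t x)) ((ω x).draw₂ s) := by
    unfold listenChannel chosen
    simp only [sum_counts_le, and_true]
  rw [h, counts_history N ω ht]
  rfl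

theorem history_slot₂_eq_some (ω : V → Tape c S) {x w : V} {s : Fin S.steps₂} {j : Fin S.rounds}
    {ℓ : Fin c}
    (h : Hears₂ N x (totals N x (tapesEquiv V c S ω).1) ((tapesEquiv V c S ω).2 s) ℓ j w) :
    (protocol V c S).history N ω (S.slots₁ + S.slots₂) x
      (S.slots₁ + (finProdFinEquiv (s, j) : ℕ)) = some w := by
  have hlt : (finProdFinEquiv (s, j) : ℕ) < S.slots₂ := (finProdFinEquiv (s, j)).isLt
  rw [history_eq_some_iff]
  refine ⟨by omega, ℓ, ?_, fun w' => ?_⟩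
  · rw [action_slot₂, action₂_eq_listen_iff, listenChannel_history N ω (by omega)]
    exact h.1
  · rw [← h.2 w']
    simp only [action_slot₂, action₂_eq_broadcast_iff]
    simp only [tapesEquiv, Equiv.coe_fn_mk]
    constructor
    · rintro ⟨h4, _, ⟨⟨h5, h7⟩, rfl, -⟩, h6⟩
      exact ⟨h4, ⟨h5, h6⟩, h7⟩
    · rintro ⟨h4, ⟨h5, h6⟩, h7⟩
      exact ⟨h4, _, ⟨⟨h5, h7⟩, rfl, trivial⟩, h6⟩

/-- Node `x` does not hear `w` in any step, where the draws of the two parts are `y`. -/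
def Misses (x w : V) (y : (Fin S.steps₁ → V → Draw₁ c S) × (Fin S.steps₂ → V → Draw₂ c S)) :
    Prop :=
  (∀ s i j, ¬ Hears₁ N x (y.1 s) i j w) ∧
    ∀ s, ¬ ∃ ℓ j, Hears₂ N x (totals N x y.1) (y.2 s) ℓ j w

theorem exists_misses_of_not_discovers {ω : V → Tape c S}
    (h : ω ∉ (protocol V c S).discovers N) :
    ∃ x w, N.graph.Adj x w ∧ Misses N x w (tapesEquiv V c S ω) := by
  by_contra hcon
  push Not at hcon
  refine h fun x => ?_
  ext w
  refine ⟨fun ⟨t, ht⟩ => adj_of_history N ht, fun hadj => ?_⟩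
  have := hcon x w hadj
  unfold Misses at this
  rw [not_and_or] at this
  push Not at this
  rcases this with ⟨s, i, j, hh⟩ | ⟨s, ℓ, j, hh⟩
  · exact ⟨_, (history_slot₁_eq_some_iff N ω (Nat.le_add_right _ _) x w s i j).mpr hh⟩
  · exact ⟨_, history_slot₂_eq_some N ω hh⟩

/-! ### Union bound over ordered pairs of neighbors -/

open FinProb

theorem discoveryProb_eq [Fintype V] [DecidableEq V] :
    (protocol V c S).discoveryProb N =
      1 - pr (fun ω : V → Tape c S => ω ∉ (protocol V c S).discovers N) := by
  classical
  have hsing : ∀ ω : V → Tape c S, (Measure.pi fun _ : V =>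
      (PMF.uniformOfFintype (Tape c S)).toMeasure).real {ω} =
        1 / Fintype.card (V → Tape c S) := fun ω => by
    rw [Measure.real, Measure.pi_singleton]
    simp_rw [PMF.toMeasure_apply_singleton _ _ (measurableSet_singleton _),
      PMF.uniformOfFintype_apply]
    simp
  have hpr := pr_not (α := V → Tape c S) fun ω => ω ∈ (protocol V c S).discovers N
  have : pr (fun ω : V → Tape c S => ω ∈ (protocol V c S).discovers N) =
      (protocol V c S).discoveryProb N := by
    have hset : ∀ A : Set (V → Tape c S), pr (fun ω => ω ∈ A) = (Measure.pi fun _ : V =>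
        (PMF.uniformOfFintype (Tape c S)).toMeasure).real A := fun A => by
      have hA : A = ((Finset.univ.filter fun ω => ω ∈ A : Finset (V → Tape c S)) :
        Set (V → Tape c S)) := by ext; simp
      have hcard := card_filter_eq_sum_ind (Finset.univ : Finset (V → Tape c S)) fun ω => ω ∈ A
      conv_rhs => rw [hA, ← sum_measureReal_singleton]
      simp_rw [hsing]
      unfold pr
      rw [Fintype.expect_eq_sum_div_card, Finset.sum_const, ← hcard, nsmul_eq_mul]
      ring
    exact hset _
  linarith

theorem one_sub_discoveryProb_le [Fintype V] [DecidableEq V] {ε : ℝ} (hε : 0 ≤ ε)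
    (h : ∀ x w, N.graph.Adj x w → pr (Misses (S := S) N x w) ≤ ε) :
    1 - (Fintype.card V : ℝ) ^ 2 * ε ≤ (protocol V c S).discoveryProb N := by
  rw [discoveryProb_eq]
  have h1 : pr (fun ω : V → Tape c S => ω ∉ (protocol V c S).discovers N) ≤
      pr (fun y => ∃ p ∈ (Finset.univ : Finset (V × V)),
        N.graph.Adj p.1 p.2 ∧ Misses (S := S) N p.1 p.2 y) := by
    rw [← (Balanced.equiv (tapesEquiv V c S)).pr]
    refine pr_mono fun ω hω => ?_
    obtain ⟨x, w, hw⟩ := exists_misses_of_not_discovers N hω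
    exact ⟨(x, w), Finset.mem_univ _, hw⟩
  have h2 := pr_exists_mem_le (Finset.univ : Finset (V × V))
    fun p y => N.graph.Adj p.1 p.2 ∧ Misses (S := S) N p.1 p.2 y
  have h3 : ∑ p : V × V, pr (fun y => N.graph.Adj p.1 p.2 ∧ Misses (S := S) N p.1 p.2 y) ≤
      ∑ _p : V × V, ε := by
    refine Finset.sum_le_sum fun p _ => ?_
    by_cases hp : N.graph.Adj p.1 p.2
    · exact (pr_mono fun y hy => hy.2).trans (h _ _ hp)
    · refine le_trans (le_of_eq ?_) hε
      rw [← pr_false (α := (Fin S.steps₁ → V → Draw₁ c S) × (Fin S.steps₂ → V → Draw₂ c S))]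
      exact pr_congr fun y => ⟨fun hy => hp hy.1, False.elim⟩
  rw [Finset.sum_const, Finset.card_univ, Fintype.card_prod, nsmul_eq_mul] at h3
  push_cast at h3
  nlinarith

end CSeek

/-! ### Exactly one of several independent events -/

namespace FinProb

theorem expect_arrow_prod {ι α β : Type*} [Fintype ι] [DecidableEq ι] [Fintype α] [Fintype β]
    (f : (ι → α × β) → ℝ) : 𝔼 y, f y = 𝔼 z : ι → α, 𝔼 k : ι → β, f fun i => (z i, k i) := by
  rw [← expect_prod_type fun p : (ι → α) × (ι → β) => f fun i => (p.1 i, p.2 i)]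
  exact Fintype.expect_equiv (Equiv.arrowProdEquivProdArrow ι (fun _ => α) (fun _ => β)) _ _
    fun _ => rfl

/-- The probability that `w` is the only member of `B` whose event `E` happens, jointly with an
event `A` at a coordinate outside of `B`. -/
theorem pr_solo {ι α : Type*} [Fintype ι] [DecidableEq ι] [Fintype α] [Nonempty α] (B : Finset ι)
    {x w : ι} (hx : x ∉ B) (hw : w ∈ B) (A : α → Prop) (E : ι → α → Prop) :
    pr (fun b : ι → α => A (b x) ∧ ∀ w', (w' ∈ B ∧ E w' (b w')) ↔ w' = w) =
      pr A * (pr (E w) * ∏ w' ∈ B.erase w, (1 - pr (E w'))) := by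
  classical
  -- Being the only member of `B` with a success is a condition on each coordinate separately, so
  -- the probability factors.
  let F : ι → α → Prop := fun i y =>
    (i = x → A y) ∧ (i ∈ B → (E i y ↔ i = w))
  have h1 : pr (fun b : ι → α => A (b x) ∧ ∀ w', (w' ∈ B ∧ E w' (b w')) ↔ w' = w) =
      pr (fun b : ι → α => ∀ i, F i (b i)) := by
    refine pr_congr fun b => ⟨fun h i => ⟨fun hi => hi ▸ h.1, fun hi => ?_⟩, fun h =>
      ⟨(h x).1 rfl, fun w' => ⟨fun hw' => ((h w').2 hw'.1).mp hw'.2, ?_⟩⟩⟩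
    · rw [← h.2 i]; simp [hi]
    · rintro rfl
      exact ⟨hw, ((h w').2 hw).mpr rfl⟩
  rw [h1, pr_pi, ← Finset.prod_subset (Finset.subset_univ (insert x B)), Finset.prod_insert hx,
    ← Finset.mul_prod_erase B _ hw]
  · congr 1
    · exact pr_congr fun y => by simp [F, hx]
    congr 1
    · exact pr_congr fun y => by
        have : w ≠ x := fun h => hx (h ▸ hw)
        simp [F, hw, this]
    · refine Finset.prod_congr rfl fun i hi => ?_
      rw [← pr_not]
      refine pr_congr fun y => ?_
      have hiB := Finset.mem_of_mem_erase hi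
      have h2 : i ≠ x := fun h => hx (h ▸ hiB)
      have h3 : i ≠ w := Finset.ne_of_mem_erase hi
      simp [F, hiB, h2, h3]
  · intro i _ hi
    rw [Finset.mem_insert, not_or] at hi
    rw [← Fintype.expect_one (ι := α) (M := ℝ)]
    exact Finset.expect_congr rfl fun y _ => ind_of (by simp [F, hi.1, hi.2])

theorem pr_coin (m : ℕ) (hm : 0 < m) : pr (fun b : Fin m => (b : ℕ) = 0) = 1 / m := by
  have := pr_eq_one_div (⟨0, hm⟩ : Fin m)
  rw [Fintype.card_fin] at this
  rw [← this]
  exact pr_congr fun b => by simp [Fin.ext_iff]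

end FinProb

namespace CSeek

open FinProb

/-! ### The counting procedure -/

/-- The probability that exactly one of `m` coins with heads probability `1 / 2 ^ i` shows heads. -/
noncomputable def soloProb (m i : ℕ) : ℝ := m * (1 / 2 ^ i) * (1 - 1 / 2 ^ i) ^ (m - 1)

/-- Bernoulli's inequality gives 1/2 for the exponent k; squaring gives 1/4. -/
theorem quarter_le_one_sub_inv_pow (k : ℕ) (hk : 0 < k) :
    (1 / 4 : ℝ) ≤ (1 - 1 / (2 * k : ℝ)) ^ (2 * k) := by
  have hk' : (1 : ℝ) ≤ k := by exact_mod_cast hk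
  have hle : 1 / (2 * k : ℝ) ≤ 1 / 2 := by
    apply one_div_le_one_div_of_le <;> linarith
  have h1 := one_add_mul_le_pow (a := -(1 / (2 * k : ℝ))) (by linarith) k
  have h2 : 1 + (k : ℝ) * -(1 / (2 * k : ℝ)) = 1 / 2 := by field_simp; norm_num
  rw [h2, ← sub_eq_add_neg] at h1
  rw [mul_comm 2 k, pow_mul]
  nlinarith

/-- With q = 2^(-i), the factor mq is at least 1, and (1-q)^(m-1) ≥ (1-q)^(2/q) ≥ (1/4)². -/
theorem soloProb_ge {m i : ℕ} (hi : 0 < i) (h1 : 2 ^ i ≤ m) (h2 : m ≤ 2 * 2 ^ i) :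
    1 / 16 ≤ soloProb m i := by
  obtain ⟨i, rfl⟩ := Nat.exists_eq_succ_of_ne_zero hi.ne'
  have hq := quarter_le_one_sub_inv_pow (2 ^ i) (by positivity)
  have e1 : (2 : ℝ) * ((2 ^ i : ℕ) : ℝ) = 2 ^ i.succ := by push_cast; rw [pow_succ']
  have e2 : 2 * 2 ^ i = 2 ^ i.succ := by rw [pow_succ']
  rw [e1, e2] at hq
  set q : ℝ := 1 / 2 ^ i.succ with hqdef
  have hq0 : 0 < q := by positivity
  have hq1 : q ≤ 1 := by
    rw [hqdef, div_le_one (by positivity)]; exact one_le_pow₀ (by norm_num)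
  have h3 : (1 - q) ^ (2 * 2 ^ i.succ) ≤ (1 - q) ^ (m - 1) :=
    pow_le_pow_of_le_one (by linarith) (by linarith) (by omega)
  have h4 : (1 / 16 : ℝ) ≤ (1 - q) ^ (2 * 2 ^ i.succ) := by
    rw [mul_comm, pow_mul]; nlinarith
  have h5 : 1 ≤ (m : ℝ) * q := by
    rw [hqdef, mul_one_div, le_div_iff₀ (by positivity), one_mul]; exact_mod_cast h1
  unfold soloProb
  rw [← hqdef]
  nlinarith

/-- The round is the one before ⌈lg m⌉, or round 0 for m = 1. For m = 2 round 0 is useless, as two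
permanent senders always collide, so round 1 must exist. -/
theorem exists_round_soloProb_ge {m R : ℕ} (hR : 0 < R) (hm : 1 ≤ m) (hmR : m ≤ 2 ^ R)
    (h2 : m = 2 → 2 ≤ R) : ∃ i < R, 2 ^ i ≤ m ∧ 1 / 16 ≤ soloProb m i := by
  rcases Nat.lt_or_ge m 3 with h3 | h3
  · interval_cases m
    · exact ⟨0, hR, le_rfl, by norm_num [soloProb]⟩
    · exact ⟨1, h2 rfl, by norm_num, soloProb_ge (by norm_num) (by norm_num) (by norm_num)⟩
  · have hc : Nat.clog 2 m ≤ R := Nat.clog_le_of_le_pow hmR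
    have hc2 : 1 < Nat.clog 2 m := by
      rw [Nat.lt_clog_iff_pow_lt (by norm_num)]; omega
    have h4 := Nat.pow_pred_clog_lt_self (b := 2) (by norm_num) (x := m) (by omega)
    have h5 := Nat.le_pow_clog (b := 2) (by norm_num) m
    have h6 : 2 ^ Nat.clog 2 m = 2 * 2 ^ (Nat.clog 2 m - 1) := by
      rw [← pow_succ']; congr 1; omega
    refine ⟨Nat.clog 2 m - 1, by omega, h4.le, soloProb_ge (by omega) h4.le (by omega)⟩

/-- With X = m/2^i the probability is about X·exp(-X). The bound X⁴/24 ≤ exp X turns this into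
65.4/X³, where 65.4 = 24·2.725, and X ≥ 64 gives 65.4/X² ≤ 1/62. The remaining factor 1/X is
summable over the rounds. -/
theorem soloProb_le {m i : ℕ} (h : 64 * 2 ^ i ≤ m) : soloProb m i ≤ 1 / 62 * (2 ^ i / m) := by
  have hm : (0 : ℝ) < m := by
    have : 0 < 2 ^ i := by positivity
    exact_mod_cast (by omega : 0 < m)
  set q : ℝ := 1 / 2 ^ i with hqdef
  have hq0 : 0 < q := by positivity
  have hq1 : q ≤ 1 := by
    rw [hqdef, div_le_one (by positivity)]; exact one_le_pow₀ (by norm_num)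
  have hx : 64 ≤ m * q := by
    rw [hqdef, mul_one_div, le_div_iff₀ (by positivity)]; exact_mod_cast h
  have hm1 : ((m - 1 : ℕ) : ℝ) = m - 1 := by
    rw [Nat.cast_sub]; · simp
    exact_mod_cast (by exact_mod_cast hm : 0 < m)
  have h1 : (1 - q) ^ (m - 1) ≤ Real.exp (q - m * q) := by
    calc (1 - q) ^ (m - 1) ≤ Real.exp (-q) ^ (m - 1) := by
          refine pow_le_pow_left₀ (by linarith) ?_ _
          have := Real.add_one_le_exp (-q); linarith
      _ = _ := by rw [← Real.exp_nat_mul, hm1]; congr 1; ring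
  have h2 : Real.exp (q - m * q) ≤ 65.4 / (m * q) ^ 4 := by
    have h4 := Real.pow_div_factorial_le_exp (m * q) (by positivity) 4
    have h5 : Real.exp q ≤ 2.725 := by
      refine (Real.exp_le_exp.mpr hq1).trans ?_
      have := Real.exp_one_lt_d9; linarith
    rw [Real.exp_sub]
    rw [div_le_div_iff₀ (Real.exp_pos _) (by positivity)]
    norm_num [Nat.factorial] at h4
    have h6 : Real.exp q * (↑m * q) ^ 4 ≤ 2.725 * (↑m * q) ^ 4 := by gcongr
    nlinarith
  have e : (2 ^ i / m : ℝ) = 1 / (m * q) := by rw [hqdef]; field_simp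
  rw [e]
  unfold soloProb
  rw [← hqdef]
  set X : ℝ := m * q with hX
  have hX0 : 0 < X := by linarith
  calc X * (1 - q) ^ (m - 1) ≤ X * (65.4 / X ^ 4) := by
        apply mul_le_mul_of_nonneg_left (h1.trans h2) hX0.le
    _ = 65.4 / X ^ 2 * (1 / X) := by field_simp
    _ ≤ 1 / 62 * (1 / X) := by
        refine mul_le_mul_of_nonneg_right ?_ (by positivity)
        rw [div_le_div_iff₀ (by positivity) (by norm_num)]
        nlinarith

variable {V : Type u} [Fintype V] [DecidableEq V] {Ch : Type v} {c : ℕ} {S : Shape}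
  (N : CRNetwork V Ch c)

theorem pr_solo_coin (B : Finset V) (i : ℕ) :
    pr (fun b : V → Fin (2 ^ i) => ∃ w, ∀ w', (w' ∈ B ∧ (b w' : ℕ) = 0) ↔ w' = w) =
      soloProb B.card i := by
  have h1 : pr (fun b : V → Fin (2 ^ i) => ∃ w, ∀ w', (w' ∈ B ∧ (b w' : ℕ) = 0) ↔ w' = w) =
      pr (fun b : V → Fin (2 ^ i) => ∃ w ∈ B, ∀ w', (w' ∈ B ∧ (b w' : ℕ) = 0) ↔ w' = w) :=
    pr_congr fun b => ⟨fun ⟨w, hw⟩ => ⟨w, ((hw w).mpr rfl).1, hw⟩, fun ⟨w, _, hw⟩ => ⟨w, hw⟩⟩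
  have hcoin := pr_coin (2 ^ i) (by positivity)
  push_cast at hcoin
  have h2 : ∀ w ∈ B, pr (fun b : V → Fin (2 ^ i) => ∀ w', (w' ∈ B ∧ (b w' : ℕ) = 0) ↔ w' = w) =
      1 / 2 ^ i * (1 - 1 / 2 ^ i) ^ (B.card - 1) := fun w hw => by
    have h3 : pr (fun b : V → Fin (2 ^ i) => ∀ w', (w' ∈ B ∧ (b w' : ℕ) = 0) ↔ w' = w) =
        pr (fun b : V → Fin (2 ^ i) => ∀ j, (j ∈ B → ((b j : ℕ) = 0 ↔ j = w))) := by
      refine pr_congr fun b => ⟨fun h j hj => by rw [← h j]; simp [hj], fun h w' =>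
        ⟨fun hw' => (h w' hw'.1).mp hw'.2, ?_⟩⟩
      rintro rfl
      exact ⟨hw, (h _ hw).mpr rfl⟩
    rw [h3, pr_pi fun j (y : Fin (2 ^ i)) => (j ∈ B → ((y : ℕ) = 0 ↔ j = w)),
      ← Finset.prod_subset (Finset.subset_univ B), ← Finset.mul_prod_erase B _ hw]
    · congr 1
      · rw [← hcoin]; exact pr_congr fun y => by simp [hw]
      · rw [← Finset.card_erase_of_mem hw, ← Finset.prod_const]
        refine Finset.prod_congr rfl fun j hj => ?_
        rw [← hcoin, ← pr_not]
        exact pr_congr fun y => by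
          simp [Finset.mem_of_mem_erase hj, Finset.ne_of_mem_erase hj]
    · intro j _ hj
      rw [← Fintype.expect_one (ι := Fin (2 ^ i)) (M := ℝ)]
      exact Finset.expect_congr rfl fun y _ => ind_of fun h => absurd h hj
  rw [h1, pr_exists_mem_eq B fun w (b : V → Fin (2 ^ i)) =>
      ∀ w', (w' ∈ B ∧ (b w' : ℕ) = 0) ↔ w' = w, Finset.sum_congr rfl h2, Finset.sum_const,
    nsmul_eq_mul]
  · unfold soloProb; ring
  · intro b w _ w' _ hw hw'
    exact (hw' w).mp ((hw w).mpr rfl)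

open Classical in
/-- The neighbors of `x` that are broadcasters on the channel of `x`, as a finite set. -/
noncomputable def speakerSet (x : V) (z : V → Fin c × Bool) : Finset V :=
  Finset.univ.filter fun w => w ∈ speakers N x z

omit [DecidableEq V] in
theorem mem_speakerSet {x w : V} {z : V → Fin c × Bool} :
    w ∈ speakerSet N x z ↔ w ∈ speakers N x z := by simp [speakerSet]

/-- The coins of one node in one step of part one. -/
abbrev Coins₁ (S : Shape) : Type := (i : Fin S.rounds) → Fin S.roundLen → Fin (2 ^ (i : ℕ))

/-- Regrouping the coins of a round by slots makes its slots independent trials. -/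
theorem balanced_coins (i : Fin S.rounds) : Balanced fun (κ : V → Coins₁ S)
    (j : Fin S.roundLen) (w : V) => κ w i j :=
  Balanced.comp (ρ := fun (κ : V → Fin S.roundLen → Fin (2 ^ (i : ℕ))) j w => κ w j)
    (π := fun (κ : V → Coins₁ S) w => κ w i)
    (Balanced.equiv (Equiv.piComm fun (_ : V) (_ : Fin S.roundLen) => Fin (2 ^ (i : ℕ))))
    (Balanced.pi fun _ => Balanced.eval i)

section

variable {x : V} {z : V → Fin c × Bool}

omit [DecidableEq V] in
theorem stepAccepts_iff (hx : (z x).2 = false) (κ : V → Coins₁ S) (i : Fin S.rounds) :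
    StepAccepts N x (fun w => (z w, κ w)) i ↔
      S.threshold * S.roundLen < ∑ j : Fin S.roundLen,
        ind (∃ w, ∀ w', (w' ∈ speakerSet N x z ∧ (κ w' i j : ℕ) = 0) ↔ w' = w) := by
  classical
  unfold StepAccepts
  rw [card_filter_eq_sum_ind]
  simp only [Hears₁, hx, true_and, mem_speakerSet]

/-- The threshold 1/64 is a quarter of the success probability 1/16, as the lower tail bound
requires. -/
theorem pr_not_stepAccepts_le (hthr : S.threshold ≤ 1 / 64) (hx : (z x).2 = false)
    (i : Fin S.rounds) (hi : 1 / 16 ≤ soloProb (speakerSet N x z).card i) :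
    pr (fun κ : V → Coins₁ S => ¬ StepAccepts N x (fun w => (z w, κ w)) i) ≤
      Real.exp (-(S.roundLen / 64)) := by
  rw [← pr_solo_coin] at hi
  have h := pr_lower_tail_univ (ι := Fin S.roundLen) _ hi
  rw [Fintype.card_fin] at h
  refine le_trans ?_ (h.trans_eq (by congr 1; ring))
  rw [← (balanced_coins (V := V) (S := S) i).pr]
  refine pr_mono fun κ hκ => ?_
  rw [stepAccepts_iff N hx, not_lt] at hκ
  refine hκ.trans ?_
  have : (0 : ℝ) ≤ S.roundLen := by positivity
  nlinarith

/-- Markov's inequality for the number of successful slots. No concentration is needed, since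
premature acceptance only has to be excluded with constant probability. -/
theorem pr_stepAccepts_le (hthr : 0 < S.threshold) (hT : 0 < S.roundLen) (hx : (z x).2 = false)
    (i : Fin S.rounds) :
    pr (fun κ : V → Coins₁ S => StepAccepts N x (fun w => (z w, κ w)) i) ≤
      soloProb (speakerSet N x z).card i / S.threshold := by
  have hT' : (0 : ℝ) < S.roundLen := by exact_mod_cast hT
  calc _ ≤ 𝔼 κ : V → Coins₁ S, (1 / (S.threshold * S.roundLen)) * ∑ j : Fin S.roundLen,
        ind (∃ w, ∀ w', (w' ∈ speakerSet N x z ∧ (κ w' i j : ℕ) = 0) ↔ w' = w) := by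
        refine pr_le_expect _ _ (fun κ => mul_nonneg (by positivity)
          (Finset.sum_nonneg fun j _ => ind_nonneg _)) fun κ hκ => ?_
        rw [stepAccepts_iff N hx] at hκ
        rw [one_div, ← div_eq_inv_mul, le_div_iff₀ (by positivity)]
        linarith
    _ = (1 / (S.threshold * S.roundLen)) * ∑ j : Fin S.roundLen,
          soloProb (speakerSet N x z).card i := by
        rw [← Finset.mul_expect, Finset.expect_sum_comm]
        congr 1
        refine Finset.sum_congr rfl fun j _ => ?_
        rw [← pr_solo_coin (speakerSet N x z) i]
        have hb : Balanced fun κ : V → Coins₁ S => fun w => κ w i j :=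
          Balanced.comp (ρ := fun k : Fin S.roundLen → V → Fin (2 ^ (i : ℕ)) => k j)
            (Balanced.eval j) (balanced_coins i)
        exact hb.pr fun b : V → Fin (2 ^ (i : ℕ)) =>
          ∃ w, ∀ w', (w' ∈ speakerSet N x z ∧ (b w' : ℕ) = 0) ↔ w' = w
    _ = _ := by
        rw [Finset.sum_const, Finset.card_univ, Fintype.card_fin, nsmul_eq_mul]
        field_simp

end

omit [DecidableEq V] in
theorem stepCount_eq_zero {x : V} {y : V → Draw₁ c S} (hthr : 0 < S.threshold)
    (h : (y x).1.2 = true ∨ speakerSet N x (fun v => (y v).1) = ∅) : stepCount N x y = 0 := by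
  rcases stepCount_cases N x y with ⟨i, h1, -, -⟩ | ⟨-, h1⟩
  · exfalso
    obtain ⟨j, w, hw1, hw2⟩ := StepAccepts.exists_hears N hthr h1
    rcases h with h | h
    · rw [h] at hw1; cases hw1
    · have := (mem_speakerSet N).mpr ((hw2 w).mpr rfl).1
      rw [h] at this
      exact absurd this (Finset.notMem_empty _)
  · exact h1

/-- The expected count is at most linear in the number of broadcasters. -/
theorem expect_stepCount_le {x : V} {z : V → Fin c × Bool} (hthr0 : 0 < S.threshold)
    (hthr : S.threshold ≤ 1 / 64) (hR : 0 < S.rounds)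
    (hT : (2 : ℝ) ^ (S.rounds + 1) * Real.exp (-(S.roundLen / 64)) ≤ 4)
    (hm : (speakerSet N x z).card ≤ 2 ^ S.rounds) :
    𝔼 κ : V → Coins₁ S, (stepCount N x (fun w => (z w, κ w)) : ℝ) ≤
      ind ((z x).2 = false) * (8 * (speakerSet N x z).card) := by
  cases hx : (z x).2 with
  | true =>
    rw [ind_of_not (by simp), zero_mul]
    refine le_of_eq (Finset.expect_eq_zero fun κ _ => ?_)
    rw [stepCount_eq_zero N hthr0 (Or.inl hx)]; simp
  | false =>
  rw [ind_of rfl, one_mul]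
  set m := (speakerSet N x z).card with hmdef
  rcases Nat.eq_zero_or_pos m with h0 | h0
  · refine (Finset.expect_eq_zero fun κ _ => ?_).trans_le (by positivity)
    rw [stepCount_eq_zero N hthr0 (Or.inr (Finset.card_eq_zero.mp h0))]; simp
  have hm1 : (1 : ℝ) ≤ m := by exact_mod_cast h0
  by_cases h2 : m = 2 → 2 ≤ S.rounds
  · obtain ⟨i, hi, h3, h4⟩ := exists_round_soloProb_ge hR h0 hm h2
    have hpr := pr_not_stepAccepts_le N hthr hx ⟨i, hi⟩ h4
    -- Acceptance of round `i` caps the count at 4·2^i ≤ 4m. Otherwise the trivial cap applies; by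
    -- `hT` it adds at most 4 ≤ 4m to the mean.
    have hb : ∀ κ : V → Coins₁ S, (stepCount N x (fun w => (z w, κ w)) : ℝ) ≤
        4 * m + 2 ^ (S.rounds + 1) * ind (¬ StepAccepts N x (fun w => (z w, κ w)) ⟨i, hi⟩) := by
      intro κ
      by_cases hacc : StepAccepts N x (fun w => (z w, κ w)) ⟨i, hi⟩
      · rw [ind_of_not (not_not.mpr hacc), mul_zero, add_zero]
        have := stepCount_le_of_accepts N hacc
        have h5 : stepCount N x (fun w => (z w, κ w)) ≤ 4 * m := by
          refine this.trans ?_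
          simp only [pow_add]; omega
        exact_mod_cast h5
      · rw [ind_of hacc, mul_one]
        have : (stepCount N x (fun w => (z w, κ w)) : ℝ) ≤ 2 ^ (S.rounds + 1) := by
          exact_mod_cast stepCount_le N x fun w => (z w, κ w)
        linarith
    refine (expect_mono hb).trans ?_
    rw [Finset.expect_add_distrib, Fintype.expect_const, ← Finset.mul_expect]
    have h6 : (2 : ℝ) ^ (S.rounds + 1) * pr (fun κ : V → Coins₁ S =>
      ¬ StepAccepts N x (fun w => (z w, κ w)) ⟨i, hi⟩) ≤ 4 := le_trans (by gcongr) hT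
    unfold pr at h6
    linarith
  -- The exception is m = 2 with a single round, where the trivial cap 2² is already below 8m.
  · push Not at h2
    have hR1 : S.rounds = 1 := by omega
    refine (expect_mono (g := fun _ => 8 * (m : ℝ)) fun κ => ?_).trans_eq
      (Fintype.expect_const _)
    have h5 : stepCount N x (fun w => (z w, κ w)) ≤ 8 * m := by
      refine (stepCount_le N x fun w => (z w, κ w)).trans ?_
      simp only [hR1]; omega
    exact_mod_cast h5

/-- A geometric series dominated by its largest term: powers 2^i ≤ m/64 add up to at most m/32, and
62·32 = 1984. -/
theorem sum_soloProb_le (m R : ℕ) :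
    ∑ i : Fin R, (if 64 * 2 ^ (i : ℕ) ≤ m then soloProb m i else 0) ≤ 1 / 1984 := by
  rcases Nat.lt_or_ge m 64 with hm | hm
  · refine (Finset.sum_nonpos fun i _ => ?_).trans (by norm_num)
    rw [if_neg]
    have : 1 ≤ 2 ^ (i : ℕ) := Nat.one_le_two_pow
    omega
  have hm0 : (0 : ℝ) < m := by exact_mod_cast (by omega : 0 < m)
  rw [Finset.sum_ite, Finset.sum_const_zero, add_zero]
  set k := Nat.log 2 (m / 64) with hk
  have hsub : ∀ i : Fin R, 64 * 2 ^ (i : ℕ) ≤ m → (i : ℕ) < k + 1 := fun i hi => by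
    have : 2 ^ (i : ℕ) ≤ m / 64 := by omega
    exact Nat.lt_succ_of_le (Nat.le_log_of_pow_le (by norm_num) this)
  have hpow : 64 * 2 ^ k ≤ m := by
    have := Nat.pow_log_le_self 2 (x := m / 64) (by omega)
    rw [← hk] at this
    omega
  calc ∑ i ∈ (Finset.univ : Finset (Fin R)).filter fun i : Fin R => 64 * 2 ^ (i : ℕ) ≤ m,
        soloProb m i
      ≤ ∑ i ∈ (Finset.univ : Finset (Fin R)).filter fun i : Fin R => 64 * 2 ^ (i : ℕ) ≤ m,
          1 / 62 * ((2 : ℝ) ^ (i : ℕ) / m) :=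
        Finset.sum_le_sum fun i hi => soloProb_le (Finset.mem_filter.mp hi).2
    _ = ∑ i ∈ ((Finset.univ : Finset (Fin R)).filter fun i : Fin R => 64 * 2 ^ (i : ℕ) ≤ m).image
          (fun i : Fin R => (i : ℕ)), 1 / 62 * ((2 : ℝ) ^ i / m) := by
        rw [Finset.sum_image fun a _ b _ h => Fin.ext h]
    _ ≤ ∑ i ∈ Finset.range (k + 1), 1 / 62 * ((2 : ℝ) ^ i / m) := by
        refine Finset.sum_le_sum_of_subset_of_nonneg ?_ fun i _ _ => by positivity
        intro i hi
        simp only [Finset.mem_image, Finset.mem_filter, Finset.mem_univ, true_and] at hi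
        obtain ⟨a, ha, rfl⟩ := hi
        exact Finset.mem_range.mpr (hsub a ha)
    _ = 1 / 62 * ((2 ^ (k + 1) - 1) / m) := by
        rw [← Finset.mul_sum, ← Finset.sum_div, geom_sum_eq (by norm_num)]
        norm_num
    _ ≤ 1 / 62 * (1 / 32) := by
        refine mul_le_mul_of_nonneg_left ?_ (by norm_num)
        rw [div_le_div_iff₀ hm0 (by norm_num)]
        have : (64 * 2 ^ k : ℝ) ≤ m := by exact_mod_cast hpow
        rw [pow_succ]; linarith
    _ = _ := by norm_num

/-- The count is at least linear in the number of broadcasters, with good probability. -/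
theorem pr_stepCount_lt_le {x : V} {z : V → Fin c × Bool} (hthr0 : 1 / 140 ≤ S.threshold)
    (hthr : S.threshold ≤ 1 / 64) (hR : 0 < S.rounds) (hT : 0 < S.roundLen)
    (hx : (z x).2 = false) (h3 : 3 ≤ (speakerSet N x z).card)
    (hm : (speakerSet N x z).card ≤ 2 ^ S.rounds) :
    pr (fun κ : V → Coins₁ S =>
      ¬ (speakerSet N x z).card < 16 * stepCount N x (fun w => (z w, κ w))) ≤
      Real.exp (-(S.roundLen / 64)) + 1 / 8 := by
  have hthr0' : 0 < S.threshold := by linarith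
  set m := (speakerSet N x z).card with hmdef
  obtain ⟨i, hi, h4, h5⟩ := exists_round_soloProb_ge hR (by omega) hm (by omega)
  have hpr := pr_not_stepAccepts_le N hthr hx ⟨i, hi⟩ h5
  have hsub : pr (fun κ : V → Coins₁ S =>
      ¬ m < 16 * stepCount N x (fun w => (z w, κ w))) ≤
      pr (fun κ : V → Coins₁ S => ¬ StepAccepts N x (fun w => (z w, κ w)) ⟨i, hi⟩ ∨
        ∃ i' ∈ (Finset.univ : Finset (Fin S.rounds)), 64 * 2 ^ (i' : ℕ) ≤ m ∧
          StepAccepts N x (fun w => (z w, κ w)) i') := by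
    refine pr_mono fun κ hκ => ?_
    by_contra hcon
    push Not at hcon
    refine hκ ?_
    rcases stepCount_cases N x (fun w => (z w, κ w)) with ⟨i₀, h6, -, h7⟩ | ⟨h6, -⟩
    -- No premature round is accepted, so m < 64·2^i₀ = 16·2^(i₀+2), which is 16 times the count.
    · have h8 : ¬ 64 * 2 ^ (i₀ : ℕ) ≤ m := fun h => hcon.2 i₀ (Finset.mem_univ _) h h6
      rw [h7, pow_add]; omega
    · exact absurd hcon.1 (h6 _)
  refine hsub.trans ((pr_or_le _ _).trans (add_le_add hpr ?_))
  refine (pr_exists_mem_le _ _).trans ?_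
  calc ∑ i' : Fin S.rounds, pr (fun κ : V → Coins₁ S => 64 * 2 ^ (i' : ℕ) ≤ m ∧
          StepAccepts N x (fun w => (z w, κ w)) i')
      ≤ ∑ i' : Fin S.rounds, (if 64 * 2 ^ (i' : ℕ) ≤ m then soloProb m i' else 0) /
          S.threshold := by
        refine Finset.sum_le_sum fun i' _ => ?_
        split_ifs with h6
        · exact (pr_mono fun κ h => h.2).trans (pr_stepAccepts_le N hthr0' hT hx i')
        · rw [zero_div, ← pr_false (α := V → Coins₁ S)]
          exact pr_mono fun κ h => h6 h.1
    _ ≤ 1 / 1984 / S.threshold := by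
        rw [← Finset.sum_div]
        exact div_le_div_of_nonneg_right (sum_soloProb_le m _) hthr0'.le
    _ ≤ 1 / 8 := by
        rw [div_le_div_iff₀ hthr0' (by norm_num)]
        linarith

end CSeek

namespace FinProb

theorem pr_two {ι α : Type*} [Fintype ι] [DecidableEq ι] [Fintype α] [Nonempty α]
    {x w : ι} (hxw : x ≠ w) (A E : α → Prop) :
    pr (fun b : ι → α => A (b x) ∧ E (b w)) = pr A * pr E := by
  have h := pr_solo {w} (x := x) (by simpa using hxw) (Finset.mem_singleton_self w) A fun _ => E
  rw [Finset.erase_singleton, Finset.prod_empty, mul_one] at h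
  rw [← h]
  refine pr_congr fun b => and_congr_right fun _ => ⟨fun hb w' => ?_, fun hb => ?_⟩
  · simp only [Finset.mem_singleton, and_iff_left_iff_imp]
    rintro rfl; exact hb
  · exact ((hb w).mpr rfl).2

end FinProb

namespace CSeek

open FinProb

variable {V : Type u} [Fintype V] {Ch : Type v} {c : ℕ} {S : Shape} (N : CRNetwork V Ch c)

/-! ### Neighbors on a channel -/

open Classical in
/-- The neighbors of `x`. -/
noncomputable def nbrs (x : V) : Finset V := Finset.univ.filter fun w => N.graph.Adj x w

open Classical in
/-- The neighbors of `x` that can access the channel that `x` calls `ℓ`. -/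
noncomputable def nbrsOn (x : V) (ℓ : Fin c) : Finset V :=
  Finset.univ.filter fun w => N.graph.Adj x w ∧ N.channel x ℓ ∈ Set.range (N.channel w)

omit [Fintype V] in
open Classical in
/-- The labels at `x` of the channels shared by `x` and `w`. -/
noncomputable def sharedLabels (x w : V) : Finset (Fin c) :=
  Finset.univ.filter fun ℓ => N.channel x ℓ ∈ Set.range (N.channel w)

theorem mem_nbrs {x w : V} : w ∈ nbrs N x ↔ N.graph.Adj x w := by simp [nbrs]

theorem mem_nbrsOn {x w : V} {ℓ : Fin c} :
    w ∈ nbrsOn N x ℓ ↔ N.graph.Adj x w ∧ ℓ ∈ sharedLabels N x w := by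
  simp [nbrsOn, sharedLabels]

theorem self_notMem_nbrsOn (x : V) (ℓ : Fin c) : x ∉ nbrsOn N x ℓ := fun h =>
  ((mem_nbrsOn N).mp h).1.ne rfl

omit [Fintype V] in
theorem card_sharedLabels (x w : V) : (sharedLabels N x w).card = (N.shared x w).ncard := by
  classical
  have : N.shared x w = ((sharedLabels N x w).map (N.channel x) : Finset Ch) := by
    ext ch
    simp only [CRNetwork.shared, sharedLabels, Set.mem_inter_iff, Set.mem_range, Finset.coe_map,
      Finset.coe_filter, Finset.mem_univ, true_and, Set.mem_image, Set.mem_ofPred_eq]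
    constructor
    · rintro ⟨⟨ℓ, rfl⟩, h⟩; exact ⟨ℓ, h, rfl⟩
    · rintro ⟨ℓ, h, rfl⟩; exact ⟨⟨ℓ, rfl⟩, h⟩
  rw [this, Set.ncard_coe_finset, Finset.card_map]

theorem card_nbrs (x : V) : (nbrs N x).card = (N.graph.neighborSet x).ncard := by
  rw [← Set.ncard_coe_finset]
  congr 1
  ext w
  simp [mem_nbrs]

theorem sum_card_nbrsOn (x : V) :
    ∑ ℓ, (nbrsOn N x ℓ).card = ∑ w ∈ nbrs N x, (sharedLabels N x w).card := by
  classical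
  have h1 : ∀ ℓ, (nbrsOn N x ℓ).card = ∑ w ∈ nbrs N x, if ℓ ∈ sharedLabels N x w then 1 else 0 := by
    intro ℓ
    rw [← Finset.card_filter]
    congr 1
    ext w
    simp [mem_nbrsOn, mem_nbrs]
  simp_rw [h1]
  rw [Finset.sum_comm]
  simp

variable {k kmax Δ : ℕ}

theorem card_nbrs_le (hN : N.HasBounds k kmax Δ) (x : V) : (nbrs N x).card ≤ Δ :=
  (card_nbrs N x).trans_le (hN.degree_le x)

theorem card_nbrsOn_le (hN : N.HasBounds k kmax Δ) (x : V) (ℓ : Fin c) :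
    (nbrsOn N x ℓ).card ≤ Δ :=
  (Finset.card_le_card fun _ hw => (mem_nbrs N).mpr ((mem_nbrsOn N).mp hw).1).trans
    (card_nbrs_le N hN x)

omit [Fintype V] in
-- Labels are injective, so exactly one of the 2c pairs of label and role qualifies.
theorem pr_role_channel (b : Bool) (x w : V) {ℓ : Fin c} (h : ℓ ∈ sharedLabels N x w) :
    pr (fun p : Fin c × Bool => p.2 = b ∧ N.channel w p.1 = N.channel x ℓ) = 1 / (2 * c) := by
  obtain ⟨e, he⟩ : N.channel x ℓ ∈ Set.range (N.channel w) := by simpa [sharedLabels] using h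
  have := pr_eq_one_div ((e, b) : Fin c × Bool)
  rw [Fintype.card_prod, Fintype.card_fin, Fintype.card_bool] at this
  push_cast at this
  rw [mul_comm (2 : ℝ), ← this]
  refine pr_congr fun p => ?_
  rw [← he, (N.channel w).injective.eq_iff, Prod.ext_iff, and_comm]

theorem pr_listens (ℓ : Fin c) : pr (fun p : Fin c × Bool => p = (ℓ, false)) = 1 / (2 * c) := by
  rw [pr_eq_one_div, Fintype.card_prod, Fintype.card_fin, Fintype.card_bool]
  push_cast
  rw [mul_comm]

variable [DecidableEq V]

omit [DecidableEq V] in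
theorem mem_speakerSet_iff {x w : V} {ℓ : Fin c} {z : V → Fin c × Bool} (hz : z x = (ℓ, false)) :
    w ∈ speakerSet N x z ↔
      w ∈ nbrsOn N x ℓ ∧ (z w).2 = true ∧ N.channel w (z w).1 = N.channel x ℓ := by
  rw [mem_speakerSet, mem_nbrsOn]
  simp only [speakers, Set.mem_ofPred_eq, hz, sharedLabels, Finset.mem_filter, Finset.mem_univ,
    true_and]
  constructor
  · rintro ⟨h1, h2, h3⟩; exact ⟨⟨h1, _, h3⟩, h2, h3⟩
  · rintro ⟨⟨h1, -⟩, h2, h3⟩; exact ⟨h1, h2, h3⟩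

omit [DecidableEq V] in
theorem card_speakerSet_eq {x : V} {ℓ : Fin c} {z : V → Fin c × Bool} (hz : z x = (ℓ, false)) :
    ((speakerSet N x z).card : ℝ) = ∑ w ∈ nbrsOn N x ℓ,
      ind ((z w).2 = true ∧ N.channel w (z w).1 = N.channel x ℓ) := by
  classical
  rw [← card_filter_eq_sum_ind]
  congr 2
  ext w
  rw [mem_speakerSet_iff N hz, Finset.mem_filter]

omit [DecidableEq V] in
theorem card_speakerSet_le (hN : N.HasBounds k kmax Δ) (x : V) (z : V → Fin c × Bool) :
    (speakerSet N x z).card ≤ Δ :=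
  (Finset.card_le_card fun _ hw => (mem_nbrs N).mpr ((mem_speakerSet N).mp hw).1).trans
    (card_nbrs_le N hN x)

/-- The conditions on the numerical data under which the counting procedure works for degrees up
to `Δ`. -/
structure Shape.Fits (S : Shape) (Δ : ℕ) : Prop where
  le_threshold : 1 / 140 ≤ S.threshold
  threshold_le : S.threshold ≤ 1 / 64
  rounds_pos : 0 < S.rounds
  roundLen_pos : 0 < S.roundLen
  le_two_pow : Δ ≤ 2 ^ S.rounds
  two_pow_le : 2 ^ S.rounds ≤ 2 * Δ
  exp_le : Δ * Real.exp (-(S.roundLen / 64)) ≤ 1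

variable [NeZero c]

/-! ### A step of part one -/

/-- Double counting: x and w meet on a given shared channel with probability 1/(2c)², and there are
at most kmax·Δ pairs of a neighbor and a channel shared with it. -/
theorem expect_card_speakerSet_le (hN : N.HasBounds k kmax Δ) (x : V) :
    𝔼 z : V → Fin c × Bool, ind ((z x).2 = false) * ((speakerSet N x z).card : ℝ) ≤
      kmax * Δ / (4 * c ^ 2) := by
  classical
  have hc : (0 : ℝ) < c := by exact_mod_cast Nat.pos_of_neZero c
  have h1 : ∀ z : V → Fin c × Bool, ind ((z x).2 = false) * ((speakerSet N x z).card : ℝ) ≤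
      ∑ ℓ, ∑ w ∈ nbrsOn N x ℓ,
        ind (z x = (ℓ, false) ∧ ((z w).2 = true ∧ N.channel w (z w).1 = N.channel x ℓ)) := by
    intro z
    cases hr : (z x).2 with
    | true =>
      rw [ind_of_not (by simp), zero_mul]
      exact Finset.sum_nonneg fun _ _ => Finset.sum_nonneg fun _ _ => ind_nonneg _
    | false =>
      have hz : z x = ((z x).1, false) := Prod.ext rfl hr
      rw [ind_of rfl, one_mul, card_speakerSet_eq N hz]
      refine le_trans (le_of_eq ?_) (Finset.single_le_sum (f := fun ℓ => ∑ w ∈ nbrsOn N x ℓ,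
        ind (z x = (ℓ, false) ∧ ((z w).2 = true ∧ N.channel w (z w).1 = N.channel x ℓ)))
        (fun _ _ => Finset.sum_nonneg fun _ _ => ind_nonneg _) (Finset.mem_univ (z x).1))
      exact Finset.sum_congr rfl fun w _ => ind_congr (by simp only [← hz, true_and])
  refine (expect_mono h1).trans ?_
  rw [Finset.expect_sum_comm]
  calc _ = ∑ ℓ, ∑ w ∈ nbrsOn N x ℓ, (1 / (2 * c) * (1 / (2 * c)) : ℝ) := by
        refine Finset.sum_congr rfl fun ℓ _ => ?_
        rw [Finset.expect_sum_comm]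
        refine Finset.sum_congr rfl fun w hw => ?_
        have hw' := (mem_nbrsOn N).mp hw
        have := pr_two (ι := V) hw'.1.ne (fun p : Fin c × Bool => p = (ℓ, false))
          (fun p => p.2 = true ∧ N.channel w p.1 = N.channel x ℓ)
        rw [pr_listens, pr_role_channel N true x w hw'.2] at this
        exact this
    _ = (∑ ℓ, (nbrsOn N x ℓ).card : ℕ) * (1 / (4 * c ^ 2)) := by
        push_cast
        rw [Finset.sum_mul]
        refine Finset.sum_congr rfl fun ℓ _ => ?_
        rw [Finset.sum_const, nsmul_eq_mul]
        congr 1; field_simp; norm_num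
    _ ≤ (kmax * Δ : ℕ) * (1 / (4 * c ^ 2)) := by
        gcongr
        rw [sum_card_nbrsOn]
        calc _ ≤ ∑ w ∈ nbrs N x, kmax := by
              refine Finset.sum_le_sum fun w hw => ?_
              rw [card_sharedLabels]
              exact (hN.overlap x w ((mem_nbrs N).mp hw)).2
          _ ≤ kmax * Δ := by
              rw [Finset.sum_const, smul_eq_mul, mul_comm]
              gcongr
              exact card_nbrs_le N hN x
    _ = _ := by push_cast; ring

theorem expect_stepCount_step_le (hN : N.HasBounds k kmax Δ) (hS : S.Fits Δ) (x : V) :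
    𝔼 y : V → Draw₁ c S, (stepCount N x y : ℝ) ≤ 2 * (kmax * Δ / c ^ 2) := by
  have hthr0 : 0 < S.threshold := by linarith [hS.le_threshold]
  have hT : (2 : ℝ) ^ (S.rounds + 1) * Real.exp (-(S.roundLen / 64)) ≤ 4 := by
    have h1 : (2 : ℝ) ^ (S.rounds + 1) ≤ 4 * Δ := by
      have : (2 : ℝ) ^ S.rounds ≤ 2 * Δ := by exact_mod_cast hS.two_pow_le
      rw [pow_succ]; linarith
    have h2 := mul_le_mul_of_nonneg_right h1 (Real.exp_pos (-(S.roundLen / 64 : ℝ))).le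
    linarith [hS.exp_le]
  rw [expect_arrow_prod]
  refine (expect_mono fun z => expect_stepCount_le N hthr0 hS.threshold_le hS.rounds_pos hT
    ((card_speakerSet_le N hN x z).trans hS.le_two_pow)).trans ?_
  have h := expect_card_speakerSet_le N hN x
  calc _ = 8 * 𝔼 z : V → Fin c × Bool, ind ((z x).2 = false) * ((speakerSet N x z).card : ℝ) := by
        rw [Finset.mul_expect]
        exact Finset.expect_congr rfl fun z _ => by ring
    _ ≤ 8 * (kmax * Δ / (4 * c ^ 2)) := by gcongr
    _ = _ := by
        have hc : (0 : ℝ) < c := by exact_mod_cast Nat.pos_of_neZero c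
        field_simp; ring

/-- In a step of part one, `x` listens on the crowded channel `ℓ` and gets a count of the order of
the expected number of broadcasters there. -/
def CountsWell (x : V) (ℓ : Fin c) (y : V → Draw₁ c S) : Prop :=
  (y x).1 = (ℓ, false) ∧ (nbrsOn N x ℓ).card < 128 * c * stepCount N x y

/-- The mean number of speakers is d/(2c), and a quarter of it is d/(8c). The coordinate of x lies
outside the neighbors, so its listening is an independent factor. -/
theorem pr_few_speakers_le (x : V) (ℓ : Fin c) :
    pr (fun z : V → Fin c × Bool => z x = (ℓ, false) ∧
      ((speakerSet N x z).card : ℝ) ≤ (nbrsOn N x ℓ).card / (8 * c)) ≤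
      1 / (2 * c) * Real.exp (-((nbrsOn N x ℓ).card / (8 * c))) := by
  have hc : (0 : ℝ) < c := by exact_mod_cast Nat.pos_of_neZero c
  have h := pr_lower_tail (nbrsOn N x ℓ) (fun i (p : Fin c × Bool) => i = x → p = (ℓ, false))
    (fun w p => p.2 = true ∧ N.channel w p.1 = N.channel x ℓ) (p := 1 / (2 * c))
    fun w hw => (pr_role_channel N true x w ((mem_nbrsOn N).mp hw).2).ge
  have e : (1 / (2 * c) * (nbrsOn N x ℓ).card / 4 : ℝ) = (nbrsOn N x ℓ).card / (8 * c) := by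
    field_simp; ring
  rw [e, Finset.prod_eq_single x] at h
  · simp only [forall_const, pr_listens] at h
    refine le_trans (pr_mono fun z hz => ⟨fun i _ hi => hi ▸ hz.1, ?_⟩) h
    rw [← card_speakerSet_eq N hz.1]
    exact hz.2
  · intro i _ hi
    rw [← Fintype.expect_one (ι := Fin c × Bool) (M := ℝ)]
    exact Finset.expect_congr rfl fun y _ => ind_of fun h => absurd h hi
  · intro h
    exact absurd (Finset.mem_compl.mpr (self_notMem_nbrsOn N x ℓ)) h

theorem pr_countsWell_ge (hN : N.HasBounds k kmax Δ) (hS : S.Fits Δ) (x : V) (ℓ : Fin c)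
    (hd : 32 * c ≤ (nbrsOn N x ℓ).card) :
    1 / (4 * c) ≤ pr (CountsWell (S := S) N x ℓ) := by
  have hc1 : (1 : ℝ) ≤ c := by exact_mod_cast Nat.pos_of_neZero c
  have hc : (0 : ℝ) < c := by linarith
  have hd' : (32 * c : ℝ) ≤ (nbrsOn N x ℓ).card := by exact_mod_cast hd
  have hd4 : (4 : ℝ) ≤ (nbrsOn N x ℓ).card / (8 * c) := by
    rw [le_div_iff₀ (by positivity)]; linarith
  have hexp : Real.exp (-(S.roundLen / 64 : ℝ)) ≤ 1 / 16 := by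
    have h1 : (32 : ℝ) ≤ Δ := by
      have : ((nbrsOn N x ℓ).card : ℝ) ≤ Δ := by exact_mod_cast card_nbrsOn_le N hN x ℓ
      linarith
    nlinarith [hS.exp_le, Real.exp_pos (-(S.roundLen / 64 : ℝ))]
  have hexp4 : Real.exp (-((nbrsOn N x ℓ).card / (8 * c) : ℝ)) ≤ 1 / 16 := by
    refine (Real.exp_le_exp.mpr (neg_le_neg hd4)).trans ?_
    rw [Real.exp_neg, one_div]
    apply inv_anti₀ (by norm_num)
    have h2 := Real.exp_one_gt_d9
    rw [show (4 : ℝ) = (4 : ℕ) * 1 by norm_num, Real.exp_nat_mul]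
    calc (16 : ℝ) = 2 ^ 4 := by norm_num
      _ ≤ _ := by gcongr; linarith
  -- Given more than d/(8c) ≥ 4 speakers, the count fails with probability at most 1/16 + 1/8 ≤ 1/4.
  -- Few speakers cost at most 1/16, and (1/(2c))·(15/16)·(3/4) ≥ 1/(4c).
  have hkey : ∀ z : V → Fin c × Bool,
      ind (z x = (ℓ, false) ∧ ¬ ((speakerSet N x z).card : ℝ) ≤ (nbrsOn N x ℓ).card / (8 * c)) *
        (3 / 4) ≤ 𝔼 κ : V → Coins₁ S, ind (CountsWell N x ℓ fun w => (z w, κ w)) := by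
    intro z
    by_cases hz : z x = (ℓ, false) ∧
      ¬ ((speakerSet N x z).card : ℝ) ≤ (nbrsOn N x ℓ).card / (8 * c)
    · rw [ind_of hz, one_mul]
      obtain ⟨hz1, hz2⟩ := hz
      push Not at hz2
      have hm : 3 ≤ (speakerSet N x z).card := by
        have : (3 : ℝ) ≤ (speakerSet N x z).card := by linarith
        exact_mod_cast this
      have h3 := pr_stepCount_lt_le (S := S) N hS.le_threshold hS.threshold_le hS.rounds_pos
        hS.roundLen_pos (by rw [hz1]) hm ((card_speakerSet_le N hN x z).trans hS.le_two_pow)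
      rw [pr_not] at h3
      refine le_trans (by linarith) (pr_mono (p := fun κ : V → Coins₁ S =>
        (speakerSet N x z).card < 16 * stepCount N x fun w => (z w, κ w)) fun κ hκ => ⟨hz1, ?_⟩)
      have hκ' : ((speakerSet N x z).card : ℝ) < 16 * stepCount N x fun w => (z w, κ w) := by
        exact_mod_cast hκ
      rw [div_lt_iff₀ (by positivity)] at hz2
      have : ((nbrsOn N x ℓ).card : ℝ) < 128 * c * stepCount N x fun w => (z w, κ w) := by
        nlinarith
      exact_mod_cast this
    · rw [ind_of_not hz, zero_mul]
      exact Finset.expect_nonneg fun _ _ => ind_nonneg _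
  have h4 : pr (fun z : V → Fin c × Bool => z x = (ℓ, false)) = 1 / (2 * c) := by
    rw [← pr_listens ℓ]
    exact (Balanced.eval (D := fun _ : V => Fin c × Bool) x).pr fun p => p = (ℓ, false)
  have h5 := pr_or_le (fun z : V → Fin c × Bool => z x = (ℓ, false) ∧
      ((speakerSet N x z).card : ℝ) ≤ (nbrsOn N x ℓ).card / (8 * c))
    (fun z : V → Fin c × Bool => z x = (ℓ, false) ∧
      ¬ ((speakerSet N x z).card : ℝ) ≤ (nbrsOn N x ℓ).card / (8 * c))
  simp only [← and_or_left, em, and_true] at h5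
  rw [h4] at h5
  have h6 := pr_few_speakers_le N x ℓ
  have h7 : 1 / (2 * c : ℝ) * Real.exp (-((nbrsOn N x ℓ).card / (8 * c))) ≤
      1 / (2 * c) * (1 / 16) := by gcongr
  unfold pr
  rw [expect_arrow_prod]
  refine le_trans ?_ (expect_mono hkey)
  rw [← Finset.expect_mul]
  unfold pr at h5 h6
  have e : 1 / (4 * c : ℝ) = 1 / (2 * c) * (1 / 2) := by field_simp; norm_num
  have h8 : 0 < 1 / (2 * c : ℝ) := by positivity
  rw [e]
  linarith

theorem quarter_pow_le {d : ℕ} (hd : d ≤ 32 * c) :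
    (1 / 4 : ℝ) ^ 16 ≤ (1 - 1 / (2 * c)) ^ d := by
  have hc1 : (1 : ℝ) ≤ c := by exact_mod_cast Nat.pos_of_neZero c
  have h1 := quarter_le_one_sub_inv_pow c (Nat.pos_of_neZero c)
  have h2 : 1 / (2 * c : ℝ) ≤ 1 := by
    rw [div_le_one (by positivity)]; linarith
  have h3 : 0 ≤ 1 / (2 * c : ℝ) := by positivity
  calc (1 / 4 : ℝ) ^ 16 ≤ ((1 - 1 / (2 * c : ℝ)) ^ (2 * c)) ^ 16 := by gcongr
    _ = (1 - 1 / (2 * c : ℝ)) ^ (32 * c) := by rw [← pow_mul]; congr 1; ring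
    _ ≤ _ := pow_le_pow_of_le_one (by linarith) (by linarith) hd

/-- In a step of part one, `x` hears `w` on one of the uncrowded channels `U`. -/
theorem pr_hears₁_ge {x w : V} (hxw : N.graph.Adj x w) (U : Finset (Fin c))
    (hU : U ⊆ sharedLabels N x w) (hd : ∀ ℓ ∈ U, (nbrsOn N x ℓ).card ≤ 32 * c)
    (i : Fin S.rounds) (hi : (i : ℕ) = 0) (j : Fin S.roundLen) :
    U.card * (1 / (4 * c ^ 2) * (1 / 4) ^ 16) ≤
      pr (fun y : V → Draw₁ c S => Hears₁ N x y i j w) := by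
  have hc1 : (1 : ℝ) ≤ c := by exact_mod_cast Nat.pos_of_neZero c
  let Ev : Fin c → (V → Fin c × Bool) → Prop := fun ℓ z => z x = (ℓ, false) ∧
    ∀ w', (w' ∈ nbrsOn N x ℓ ∧ ((z w').2 = true ∧ N.channel w' (z w').1 = N.channel x ℓ)) ↔ w' = w
  have h1 : ∀ ℓ ∈ U, 1 / (4 * c ^ 2) * (1 / 4) ^ 16 ≤ pr (Ev ℓ) := by
    intro ℓ hℓ
    have hw : w ∈ nbrsOn N x ℓ := (mem_nbrsOn N).mpr ⟨hxw, hU hℓ⟩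
    have h2 := pr_solo (nbrsOn N x ℓ) (self_notMem_nbrsOn N x ℓ) hw
      (fun p : Fin c × Bool => p = (ℓ, false))
      (fun w' p => p.2 = true ∧ N.channel w' p.1 = N.channel x ℓ)
    rw [pr_listens, pr_role_channel N true x w (hU hℓ)] at h2
    rw [Finset.prod_congr rfl fun w' hw' => by
      rw [pr_role_channel N true x w' ((mem_nbrsOn N).mp (Finset.mem_of_mem_erase hw')).2],
      Finset.prod_const] at h2
    refine le_trans ?_ h2.ge
    have h3 := quarter_pow_le (c := c) (d := ((nbrsOn N x ℓ).erase w).card)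
      ((Finset.card_le_card (Finset.erase_subset _ _)).trans (hd ℓ hℓ))
    have e : 1 / (4 * c ^ 2 : ℝ) = 1 / (2 * c) * (1 / (2 * c)) := by field_simp; norm_num
    rw [e, mul_assoc]
    gcongr
  have h4 : Balanced fun (y : V → Draw₁ c S) v => (y v).1 := Balanced.pi fun _ => Balanced.fst
  calc _ = ∑ _ℓ ∈ U, (1 / (4 * c ^ 2) * (1 / 4) ^ 16 : ℝ) := by
        rw [Finset.sum_const, nsmul_eq_mul]
    _ ≤ ∑ ℓ ∈ U, pr (Ev ℓ) := Finset.sum_le_sum h1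
    _ = pr (fun z => ∃ ℓ ∈ U, Ev ℓ z) := by
        refine (pr_exists_mem_eq U Ev ?_).symm
        rintro z ℓ - ℓ' - ⟨h, -⟩ ⟨h', -⟩
        exact congrArg Prod.fst (h.symm.trans h')
    _ = pr (fun y : V → Draw₁ c S => ∃ ℓ ∈ U, Ev ℓ fun v => (y v).1) := (h4.pr _).symm
    _ ≤ _ := by
        refine pr_mono ?_
        rintro y ⟨ℓ, -, hz, h5⟩
        have hz' : (y x).1 = (ℓ, false) := hz
        refine ⟨by rw [hz'], fun w' => ?_⟩
        rw [← h5 w', ← mem_speakerSet, mem_speakerSet_iff N hz]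
        -- In round 0 the coin lives in `Fin 1`, so every speaker sends.
        have : ((y w').2 i j : ℕ) = 0 := by
          have := ((y w').2 i j).isLt
          have h6 : 2 ^ (i : ℕ) = 1 := by rw [hi, pow_zero]
          omega
        simp only [this, and_true]

end CSeek

namespace CSeek

open FinProb

variable {V : Type u} [Fintype V] [DecidableEq V] {Ch : Type v} {c : ℕ} [NeZero c] {S : Shape}
  (N : CRNetwork V Ch c) {k kmax Δ : ℕ}

/-! ### The totals after part one -/

/-- Counts are at most 2·2^rounds ≤ 4Δ. Divided by 4Δ they fit the upper tail bound with μ =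
kmax/c², and 12 = 3·4. -/
theorem pr_totals_large_le (hN : N.HasBounds k kmax Δ) (hS : S.Fits Δ) (hΔ : 0 < Δ) (x : V) :
    pr (fun y : Fin S.steps₁ → V → Draw₁ c S =>
      12 * Δ * (kmax / c ^ 2 * S.steps₁) ≤ ((∑ ℓ, totals N x y ℓ : ℕ) : ℝ)) ≤
      Real.exp (-(kmax / c ^ 2 * S.steps₁)) := by
  have hΔ' : (0 : ℝ) < Δ := by exact_mod_cast hΔ
  have hc : (0 : ℝ) < c := by exact_mod_cast Nat.pos_of_neZero c
  have h := pr_upper_tail (ι := Fin S.steps₁)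
    (fun y : V → Draw₁ c S => (stepCount N x y : ℝ) / (4 * Δ)) (fun y => by positivity)
    (fun y => by
      rw [div_le_one (by positivity)]
      have h1 := stepCount_le N x y
      have h2 := hS.two_pow_le
      rw [pow_succ] at h1
      exact_mod_cast (by omega : stepCount N x y ≤ 4 * Δ))
    (μ := kmax / c ^ 2) (by
      rw [← Finset.expect_div, div_le_iff₀ (by positivity)]
      refine (expect_stepCount_step_le N hN hS x).trans ?_
      have : 0 ≤ (kmax * Δ / c ^ 2 : ℝ) := by positivity
      have e : (kmax / c ^ 2 * (4 * Δ) : ℝ) = 4 * (kmax * Δ / c ^ 2) := by ring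
      rw [e]; linarith)
  rw [Fintype.card_fin] at h
  refine le_trans (pr_mono fun y hy => ?_) h
  rw [sum_totals] at hy
  push_cast at hy
  rw [← Finset.sum_div, le_div_iff₀ (by positivity)]
  linarith

/-- More than `steps₁`/(16c) steps count well, a quarter of the guaranteed mean, and each adds at
least d/(128c); 16·128 = 2048. -/
theorem pr_total_small_le (hN : N.HasBounds k kmax Δ) (hS : S.Fits Δ) (x : V) (ℓ : Fin c)
    (hd : 32 * c ≤ (nbrsOn N x ℓ).card) :
    pr (fun y : Fin S.steps₁ → V → Draw₁ c S =>
      (totals N x y ℓ : ℝ) ≤ S.steps₁ * (nbrsOn N x ℓ).card / (2048 * c ^ 2)) ≤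
      Real.exp (-(S.steps₁ / (16 * c))) := by
  classical
  have hc : (0 : ℝ) < c := by exact_mod_cast Nat.pos_of_neZero c
  have h := pr_lower_tail_univ (ι := Fin S.steps₁) _ (pr_countsWell_ge N hN hS x ℓ hd)
  have e : (1 / (4 * c) * S.steps₁ / 4 : ℝ) = S.steps₁ / (16 * c) := by field_simp; ring
  rw [Fintype.card_fin, e] at h
  refine le_trans (pr_mono fun y hy => ?_) h
  have hd0 : (0 : ℝ) < (nbrsOn N x ℓ).card := by
    have : 0 < c := Nat.pos_of_neZero c
    exact_mod_cast (by omega : 0 < (nbrsOn N x ℓ).card)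
  have h1 : (∑ s, ind (CountsWell N x ℓ (y s))) * ((nbrsOn N x ℓ).card / (128 * c)) ≤
      (totals N x y ℓ : ℝ) := by
    unfold totals
    push_cast
    rw [Finset.sum_mul]
    refine Finset.sum_le_sum fun s _ => ?_
    by_cases hs : CountsWell N x ℓ (y s)
    · rw [ind_of hs, one_mul, if_pos (by rw [hs.1]), div_le_iff₀ (by positivity)]
      have := hs.2
      have h2 : ((nbrsOn N x ℓ).card : ℝ) < 128 * c * stepCount N x (y s) := by exact_mod_cast this
      linarith
    · rw [ind_of_not hs, zero_mul]
      split_ifs <;> positivity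
  have h2 := h1.trans hy
  have e2 : (S.steps₁ * (nbrsOn N x ℓ).card / (2048 * c ^ 2) : ℝ) =
      S.steps₁ / (16 * c) * ((nbrsOn N x ℓ).card / (128 * c)) := by field_simp; ring
  rw [e2] at h2
  exact le_of_mul_le_mul_right h2 (by positivity)

/-! ### A step of part two -/

omit [NeZero c] in
theorem pick_eq_some {X : Fin c → ℕ} {r : ℕ} {ℓ : Fin c} (h1 : ∑ i ∈ Finset.Iio ℓ, X i < r)
    (h2 : r ≤ ∑ i ∈ Finset.Iic ℓ, X i) : pick X r = some ℓ := by
  unfold pick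
  rw [List.find?_eq_some_iff_getElem]
  refine ⟨by simpa using h2, ℓ, by simp, by simp, fun j hj => ?_⟩
  simp only [List.getElem_finRange, Fin.cast_mk, Bool.not_eq_true', decide_eq_false_iff_not,
    not_le]
  refine lt_of_le_of_lt (Finset.sum_le_sum_of_subset ?_) h1
  intro a ha
  rw [Finset.mem_Iic] at ha
  rw [Finset.mem_Iio]
  exact lt_of_le_of_lt ha hj

omit [NeZero c] in
theorem pr_chosen_ge {X : Fin c → ℕ} (h0 : 0 < ∑ ℓ, X ℓ) (h1 : ∑ ℓ, X ℓ ≤ S.maxTotal)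
    (ℓ : Fin c) : (X ℓ : ℝ) / (∑ ℓ, X ℓ : ℕ) ≤
      pr (fun d : (i : Fin S.maxTotal) → Fin ((i : ℕ) + 1) => chosen X d = some ℓ) := by
  classical
  unfold chosen
  simp only [h0, h1, and_self, dif_pos]
  set i₀ : Fin S.maxTotal := ⟨∑ ℓ, X ℓ - 1, by omega⟩ with hi₀
  have hb := (Balanced.eval (D := fun i : Fin S.maxTotal => Fin ((i : ℕ) + 1)) i₀).pr
    fun r => pick X ((r : ℕ) + 1) = some ℓ
  rw [hb]
  have hval : (i₀ : ℕ) + 1 = ∑ ℓ, X ℓ := by simp only [hi₀]; omega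
  rw [← hval]
  unfold pr
  rw [Fintype.expect_eq_sum_div_card, Fintype.card_fin, ← card_filter_eq_sum_ind]
  gcongr
  have hsplit : ∑ i ∈ Finset.Iic ℓ, X i = X ℓ + ∑ i ∈ Finset.Iio ℓ, X i := by
    rw [← Finset.Iio_insert, Finset.sum_insert (by simp)]
  have hle : ∑ i ∈ Finset.Iic ℓ, X i ≤ ∑ ℓ, X ℓ :=
    Finset.sum_le_sum_of_subset (Finset.subset_univ _)
  -- The draws that select ℓ include the `X ℓ` values following the partial sum below ℓ.
  let f : Fin (X ℓ) → Fin ((i₀ : ℕ) + 1) := fun a =>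
    ⟨∑ i ∈ Finset.Iio ℓ, X i + a, by have := a.isLt; omega⟩
  have hf : Function.Injective f := fun a b hab => by
    have := congrArg Fin.val hab
    simp only [f] at this
    exact Fin.ext (by omega)
  calc X ℓ = (Finset.univ.image f).card := by
        rw [Finset.card_image_of_injective _ hf, Finset.card_univ, Fintype.card_fin]
    _ ≤ _ := by
        refine Finset.card_le_card (s := Finset.univ.image f) ?_
        intro r hr
        obtain ⟨a, -, rfl⟩ := Finset.mem_image.mp hr
        refine Finset.mem_filter.mpr ⟨Finset.mem_univ _, pick_eq_some ?_ ?_⟩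
        · simp only [f]; omega
        · have := a.isLt
          simp only [f]; omega

/-- The coins of one node in one step of part two. -/
abbrev Coins₂ (S : Shape) : Type := (j : Fin S.rounds) → Fin (2 ^ (S.rounds - (j : ℕ)))

/-- The draws of one node for its choice of a channel to listen on in one step of part two. -/
abbrev Picks (S : Shape) : Type := (i : Fin S.maxTotal) → Fin ((i : ℕ) + 1)

/-- The least r with d ≤ 2^r·c gives the slot with sending probability 2^(-r). Each neighbor then
sends on ℓ with probability between 1/(4d) and 1/(2d). Positivity of r ensures that the slot,
numbered `rounds` - r, exists. -/
theorem exists_slot {d R : ℕ} (hd : 32 * c ≤ d) (hdR : d ≤ 2 ^ R) :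
    ∃ r, 0 < r ∧ r ≤ R ∧ d ≤ 2 ^ r * c ∧ 2 ^ r * c ≤ 2 * d := by
  have hc : 0 < c := Nat.pos_of_neZero c
  have h : ∃ r, d ≤ 2 ^ r * c := ⟨R, hdR.trans (Nat.le_mul_of_pos_right _ hc)⟩
  classical
  have h1 := Nat.find_spec h
  have h0 : 0 < Nat.find h := by
    rw [Nat.find_pos]; simp only [pow_zero, one_mul]; omega
  refine ⟨Nat.find h, h0, Nat.find_min' h (hdR.trans (Nat.le_mul_of_pos_right _ hc)), h1, ?_⟩
  have h2 := Nat.find_min h (Nat.sub_lt h0 one_pos)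
  have h3 : 2 ^ Nat.find h = 2 * 2 ^ (Nat.find h - 1) := by
    rw [← pow_succ']; congr 1; omega
  rw [h3, mul_assoc]
  omega

/-- In a step of part two, `x` listens on the crowded channel `ℓ` and hears `w`. -/
theorem pr_hears₂_one_ge {x w : V} (hxw : N.graph.Adj x w) (hN : N.HasBounds k kmax Δ)
    (hS : S.Fits Δ) {ℓ : Fin c} (hℓ : ℓ ∈ sharedLabels N x w)
    (hd : 32 * c ≤ (nbrsOn N x ℓ).card) {X : Fin c → ℕ} (h0 : 0 < ∑ ℓ, X ℓ)
    (h1 : ∑ ℓ, X ℓ ≤ S.maxTotal) :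
    ∃ j, (X ℓ : ℝ) / (∑ ℓ, X ℓ : ℕ) / (16 * (nbrsOn N x ℓ).card) ≤
      pr (fun y : V → Draw₂ c S => Hears₂ N x X y ℓ j w) := by
  have hc1 : 0 < c := Nat.pos_of_neZero c
  have hc : (0 : ℝ) < c := by exact_mod_cast hc1
  obtain ⟨r, hr0, hrR, hr1, hr2⟩ := exists_slot hd
    ((card_nbrsOn_le N hN x ℓ).trans hS.le_two_pow)
  set d := (nbrsOn N x ℓ).card with hdd
  have hd0 : (0 : ℝ) < d := by exact_mod_cast (by omega : 0 < d)
  have hj : S.rounds - r < S.rounds := by omega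
  refine ⟨⟨S.rounds - r, hj⟩, ?_⟩
  set j : Fin S.rounds := ⟨S.rounds - r, hj⟩ with hjdef
  have hjr : S.rounds - (j : ℕ) = r := by simp only [hjdef]; omega
  set E : V → Draw₂ c S → Prop := fun w' p =>
    (p.1.1 = true ∧ N.channel w' p.1.2 = N.channel x ℓ) ∧ (p.2.1 j : ℕ) = 0 with hE
  set A : Draw₂ c S → Prop := fun p => p.1.1 = false ∧ chosen X p.2.2 = some ℓ with hA
  have hwB : w ∈ nbrsOn N x ℓ := (mem_nbrsOn N).mpr ⟨hxw, hℓ⟩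
  have hsolo := pr_solo (nbrsOn N x ℓ) (self_notMem_nbrsOn N x ℓ) hwB A E
  have hpE : ∀ w' ∈ nbrsOn N x ℓ, pr (E w') = 1 / (2 * c) * (1 / 2 ^ r) := by
    intro w' hw'
    have e1 : pr (fun p : Bool × Fin c => p.1 = true ∧ N.channel w' p.2 = N.channel x ℓ) =
        1 / (2 * c) := by
      rw [← pr_role_channel N true x w' ((mem_nbrsOn N).mp hw').2]
      exact (Balanced.equiv (Equiv.prodComm Bool (Fin c))).pr fun p : Fin c × Bool =>
        p.2 = true ∧ N.channel w' p.1 = N.channel x ℓ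
    have e2 : pr (fun q : Coins₂ S × Picks S => (q.1 j : ℕ) = 0) = 1 / 2 ^ r := by
      have e3 := pr_coin (2 ^ (S.rounds - (j : ℕ))) (by positivity)
      push_cast at e3
      refine Eq.trans ?_ (e3.trans (by rw [hjr]))
      exact (Balanced.comp (Balanced.eval
        (D := fun j : Fin S.rounds => Fin (2 ^ (S.rounds - (j : ℕ)))) j)
        (Balanced.fst (α := Coins₂ S) (β := Picks S))).pr fun b => (b : ℕ) = 0
    rw [← e1, ← e2]
    exact pr_prod (fun p : Bool × Fin c => p.1 = true ∧ N.channel w' p.2 = N.channel x ℓ)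
      (fun q : Coins₂ S × Picks S => (q.1 j : ℕ) = 0)
  have hpA : 1 / 2 * ((X ℓ : ℝ) / (∑ ℓ, X ℓ : ℕ)) ≤ pr A := by
    have e1 : pr (fun p : Bool × Fin c => p.1 = false) = 1 / 2 := by
      have := pr_eq_one_div false
      rw [Fintype.card_bool] at this
      push_cast at this
      rw [← this]
      exact Balanced.fst.pr fun b => b = false
    have e2 : pr (fun q : Coins₂ S × Picks S => chosen X q.2 = some ℓ) =
        pr (fun d : (i : Fin S.maxTotal) → Fin ((i : ℕ) + 1) => chosen X d = some ℓ) :=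
      Balanced.snd.pr fun d => chosen X d = some ℓ
    have e3 : pr A = _ := pr_prod (fun p : Bool × Fin c => p.1 = false)
      (fun q : Coins₂ S × Picks S => chosen X q.2 = some ℓ)
    rw [e3, e1, e2]
    gcongr
    exact pr_chosen_ge h0 h1 ℓ
  have hq : (1 / (4 * d) : ℝ) ≤ 1 / (2 * c) * (1 / 2 ^ r) := by
    have : (2 ^ r * c : ℝ) ≤ 2 * d := by exact_mod_cast hr2
    rw [div_mul_div_comm, div_le_div_iff₀ (by positivity) (by positivity)]
    linarith
  have hq2 : (1 / (2 * c) * (1 / 2 ^ r) : ℝ) ≤ 1 / (2 * d) := by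
    have : (d : ℝ) ≤ 2 ^ r * c := by exact_mod_cast hr1
    rw [div_mul_div_comm, mul_one]
    apply div_le_div_of_nonneg_left (by norm_num) (by positivity) (by linarith)
  -- Bernoulli's inequality: the sending probabilities add up to at most 1/2. In all, 16 = 2·4·2
  -- from the listener's role, the sending of w and the silence of the others.
  have hprod : (1 / 2 : ℝ) ≤ ∏ w' ∈ (nbrsOn N x ℓ).erase w, (1 - pr (E w')) := by
    rw [Finset.prod_congr rfl fun w' hw' => by rw [hpE w' (Finset.mem_of_mem_erase hw')],
      Finset.prod_const]
    set q : ℝ := 1 / (2 * c) * (1 / 2 ^ r) with hqq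
    have hqd : q * d ≤ 1 / 2 := by
      calc q * d ≤ 1 / (2 * d) * d := by gcongr
        _ = 1 / 2 := by field_simp
    have hd1 : (1 : ℝ) ≤ d := by exact_mod_cast (by omega : 1 ≤ d)
    have hq0 : 0 ≤ q := by positivity
    have hq1 : q ≤ 1 / 2 := by nlinarith
    have hb := one_add_mul_le_pow (a := -q) (by linarith) d
    calc (1 / 2 : ℝ) ≤ (1 - q) ^ d := by rw [← sub_eq_add_neg] at hb; linarith
      _ ≤ _ := pow_le_pow_of_le_one (by linarith) (by linarith)
          (Finset.card_le_card (Finset.erase_subset _ _))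
  have hmain : (X ℓ : ℝ) / (∑ ℓ, X ℓ : ℕ) / (16 * d) ≤
      pr A * (pr (E w) * ∏ w' ∈ (nbrsOn N x ℓ).erase w, (1 - pr (E w'))) := by
    rw [hpE w hwB]
    calc (X ℓ : ℝ) / (∑ ℓ, X ℓ : ℕ) / (16 * d) =
        1 / 2 * ((X ℓ : ℝ) / (∑ ℓ, X ℓ : ℕ)) * (1 / (4 * d) * (1 / 2)) := by
          field_simp; ring
      _ ≤ _ := by
          refine mul_le_mul hpA ?_ (by positivity) (pr_nonneg _)
          refine mul_le_mul hq hprod (by norm_num) (by positivity)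
  refine hmain.trans (hsolo.ge.trans (pr_mono fun y hy => ⟨hy.1, fun w' => ?_⟩))
  rw [← hy.2 w', mem_nbrsOn]
  simp only [hE]
  constructor
  · rintro ⟨h2, h3, h4⟩
    refine ⟨⟨h2, ?_⟩, h3, h4⟩
    simp only [sharedLabels, Finset.mem_filter, Finset.mem_univ, true_and]
    exact ⟨_, h3.2⟩
  · rintro ⟨⟨h2, -⟩, h3, h4⟩
    exact ⟨h2, h3, h4⟩

/-- In a step of part two, `x` hears `w` on one of the crowded channels `U`. -/
theorem pr_hears₂_ge {x w : V} (hxw : N.graph.Adj x w) (hN : N.HasBounds k kmax Δ)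
    (hS : S.Fits Δ) (U : Finset (Fin c)) (hU : U ⊆ sharedLabels N x w)
    (hd : ∀ ℓ ∈ U, 32 * c ≤ (nbrsOn N x ℓ).card) {X : Fin c → ℕ} (h0 : 0 < ∑ ℓ, X ℓ)
    (h1 : ∑ ℓ, X ℓ ≤ S.maxTotal) {ρ : ℝ}
    (hX : ∀ ℓ ∈ U, ρ * (nbrsOn N x ℓ).card ≤ (X ℓ : ℝ) / (∑ ℓ, X ℓ : ℕ)) :
    U.card * (ρ / 16) ≤
      pr (fun y : V → Draw₂ c S => ∃ ℓ j, Hears₂ N x X y ℓ j w) := by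
  have hc1 : 0 < c := Nat.pos_of_neZero c
  have hex : ∀ ℓ, ∃ j, ℓ ∈ U → ρ / 16 ≤ pr (fun y : V → Draw₂ c S => Hears₂ N x X y ℓ j w) := by
    intro ℓ
    by_cases hℓ : ℓ ∈ U
    · obtain ⟨j, hj⟩ := pr_hears₂_one_ge N hxw hN hS (hU hℓ) (hd ℓ hℓ) h0 h1
      refine ⟨j, fun _ => le_trans ?_ hj⟩
      have := hd ℓ hℓ
      have hd0 : (0 : ℝ) < (nbrsOn N x ℓ).card := by
        exact_mod_cast (by omega : 0 < (nbrsOn N x ℓ).card)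
      rw [le_div_iff₀ (by positivity)]
      linarith [hX ℓ hℓ]
    · exact ⟨⟨0, hS.rounds_pos⟩, fun h => absurd h hℓ⟩
  choose j hj using hex
  calc U.card * (ρ / 16) = ∑ _ℓ ∈ U, ρ / 16 := by rw [Finset.sum_const, nsmul_eq_mul]
    _ ≤ ∑ ℓ ∈ U, pr (fun y : V → Draw₂ c S => Hears₂ N x X y ℓ (j ℓ) w) :=
        Finset.sum_le_sum fun ℓ hℓ => hj ℓ hℓ
    _ = pr (fun y : V → Draw₂ c S => ∃ ℓ ∈ U, Hears₂ N x X y ℓ (j ℓ) w) := by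
        refine (pr_exists_mem_eq U (fun ℓ y => Hears₂ N x X y ℓ (j ℓ) w) ?_).symm
        rintro y ℓ - ℓ' - ⟨⟨-, h⟩, -⟩ ⟨⟨-, h'⟩, -⟩
        exact Option.some.inj (h.symm.trans h')
    _ ≤ _ := pr_mono fun y ⟨ℓ, _, h⟩ => ⟨ℓ, j ℓ, h⟩

end CSeek

namespace CSeek

open FinProb

section

variable {V : Type u} [Fintype V] [DecidableEq V] {Ch : Type v} {c : ℕ} [NeZero c] {S : Shape}
  (N : CRNetwork V Ch c) {k kmax Δ : ℕ}

/-! ### Discovery of a single neighbor -/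

theorem pr_misses_le_of_uncrowded {x w : V} (hxw : N.graph.Adj x w)
    (hS : S.Fits Δ) (U : Finset (Fin c)) (hU : U ⊆ sharedLabels N x w)
    (hd : ∀ ℓ ∈ U, (nbrsOn N x ℓ).card ≤ 32 * c) :
    pr (Misses (S := S) N x w) ≤
      Real.exp (-(U.card * (1 / (4 * c ^ 2) * (1 / 4) ^ 16) * S.steps₁)) := by
  have h1 := pr_hears₁_ge (S := S) N hxw U hU hd ⟨0, hS.rounds_pos⟩ rfl ⟨0, hS.roundLen_pos⟩
  have h2 := pr_forall_not_le (ι := Fin S.steps₁) _ h1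
  rw [Fintype.card_fin] at h2
  refine le_trans ?_ h2
  rw [← (Balanced.fst (α := Fin S.steps₁ → V → Draw₁ c S)
    (β := Fin S.steps₂ → V → Draw₂ c S)).pr]
  exact pr_mono fun y hy s => hy.1 s _ _

omit [DecidableEq V] in
-- Each of at most Δ neighbors is counted on at most c channels. This keeps the union bound over
-- crowded channels free of c, which may be huge compared with n.
theorem card_crowded_le (hN : N.HasBounds k kmax Δ) (x : V) (U : Finset (Fin c))
    (hd : ∀ ℓ ∈ U, 32 * c ≤ (nbrsOn N x ℓ).card) : U.card ≤ Δ := by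
  have hc : 0 < c := Nat.pos_of_neZero c
  have h1 : U.card * (32 * c) ≤ ∑ ℓ, (nbrsOn N x ℓ).card := by
    calc U.card * (32 * c) = ∑ _ℓ ∈ U, 32 * c := by rw [Finset.sum_const, smul_eq_mul]
      _ ≤ ∑ ℓ ∈ U, (nbrsOn N x ℓ).card := Finset.sum_le_sum hd
      _ ≤ _ := Finset.sum_le_sum_of_subset (Finset.subset_univ _)
  have h2 : ∑ ℓ, (nbrsOn N x ℓ).card ≤ Δ * c := by
    rw [sum_card_nbrsOn]
    calc _ ≤ ∑ _w ∈ nbrs N x, c := Finset.sum_le_sum fun w _ => by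
          simpa using Finset.card_le_univ (sharedLabels N x w)
      _ ≤ Δ * c := by
          rw [Finset.sum_const, smul_eq_mul]
          exact Nat.mul_le_mul_right _ (card_nbrs_le N hN x)
  have h3 : U.card * 32 * c ≤ Δ * c := by rw [mul_assoc]; exact h1.trans h2
  have := Nat.le_of_mul_le_mul_right h3 hc
  omega

theorem pr_misses_le_of_crowded {x w : V} (hxw : N.graph.Adj x w) (hN : N.HasBounds k kmax Δ)
    (hS : S.Fits Δ) (hs : 0 < S.steps₁) (U : Finset (Fin c)) (hU : U ⊆ sharedLabels N x w)
    (hne : U.Nonempty) (hd : ∀ ℓ ∈ U, 32 * c ≤ (nbrsOn N x ℓ).card) :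
    pr (Misses (S := S) N x w) ≤ Real.exp (-(kmax / c ^ 2 * S.steps₁)) +
      Δ * Real.exp (-(S.steps₁ / (16 * c))) +
      Real.exp (-(U.card * (1 / (24576 * (kmax * Δ)) / 16) * S.steps₂)) := by
  have hc1 : 0 < c := Nat.pos_of_neZero c
  have hc : (0 : ℝ) < c := by exact_mod_cast hc1
  have hs' : (0 : ℝ) < S.steps₁ := by exact_mod_cast hs
  have hkmax : (0 : ℝ) < kmax := by exact_mod_cast hN.one_le_k.trans hN.k_le_kmax
  have hdpos : ∀ ℓ ∈ U, (0 : ℝ) < (nbrsOn N x ℓ).card := fun ℓ hℓ => by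
    have := hd ℓ hℓ
    exact_mod_cast (by omega : 0 < (nbrsOn N x ℓ).card)
  obtain ⟨ℓ₀, hℓ₀⟩ := hne
  have hΔ : 0 < Δ := by
    have := hdpos ℓ₀ hℓ₀
    have h' : 0 < (nbrsOn N x ℓ₀).card := by exact_mod_cast this
    exact h'.trans_le (card_nbrsOn_le N hN x ℓ₀)
  have hΔ' : (0 : ℝ) < Δ := by exact_mod_cast hΔ
  let small : Fin c → (Fin S.steps₁ → V → Draw₁ c S) → Prop := fun ℓ y =>
    (totals N x y ℓ : ℝ) ≤ S.steps₁ * (nbrsOn N x ℓ).card / (2048 * c ^ 2)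
  let large : (Fin S.steps₁ → V → Draw₁ c S) → Prop := fun y =>
    12 * Δ * (kmax / c ^ 2 * S.steps₁) ≤ ((∑ ℓ, totals N x y ℓ : ℕ) : ℝ)
  have hbad : pr (fun y => large y ∨ ∃ ℓ ∈ U, small ℓ y) ≤
      Real.exp (-(kmax / c ^ 2 * S.steps₁)) + Δ * Real.exp (-(S.steps₁ / (16 * c))) := by
    refine (pr_or_le _ _).trans (add_le_add (pr_totals_large_le N hN hS hΔ x) ?_)
    refine (pr_exists_mem_le U small).trans ((Finset.sum_le_sum fun ℓ hℓ =>
      pr_total_small_le N hN hS x ℓ (hd ℓ hℓ)).trans ?_)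
    rw [Finset.sum_const, nsmul_eq_mul]
    gcongr
    exact card_crowded_le N hN x U hd
  -- Part one is fixed with good totals; only the randomness of part two remains.
  refine (pr_prod_le _ _ (Real.exp_pos _).le fun y hy => ?_).trans (add_le_add_left hbad _)
  rw [not_or] at hy
  obtain ⟨hlarge, hsmall⟩ := hy
  simp only [large, not_le] at hlarge
  have hsmall' : ∀ ℓ ∈ U, (S.steps₁ * (nbrsOn N x ℓ).card / (2048 * c ^ 2) : ℝ) <
      totals N x y ℓ := fun ℓ hℓ => not_le.mp fun h => hsmall ⟨ℓ, hℓ, h⟩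
  have hpos : 0 < ∑ ℓ, totals N x y ℓ := by
    have h1 : (0 : ℝ) < totals N x y ℓ₀ := by
      have := hdpos ℓ₀ hℓ₀
      exact lt_of_le_of_lt (by positivity) (hsmall' ℓ₀ hℓ₀)
    have h2 : 0 < totals N x y ℓ₀ := by exact_mod_cast h1
    exact h2.trans_le (Finset.single_le_sum (f := totals N x y) (fun _ _ => Nat.zero_le _)
      (Finset.mem_univ _))
  have hpos' : (0 : ℝ) < (∑ ℓ, totals N x y ℓ : ℕ) := by exact_mod_cast hpos
  have h3 := pr_hears₂_ge N hxw hN hS U hU hd hpos (sum_totals_le N x y)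
    (ρ := 1 / (24576 * (kmax * Δ))) fun ℓ hℓ => by
      rw [le_div_iff₀ hpos']
      refine le_trans ?_ (hsmall' ℓ hℓ).le
      have hdp := hdpos ℓ hℓ
      -- The ratio of the two bounds on totals is d/(24576·kmax·Δ), as 24576 = 12·2048; `steps₁` and
      -- c² cancel.
      calc _ ≤ 1 / (24576 * (kmax * Δ)) * (nbrsOn N x ℓ).card *
            (12 * Δ * (kmax / c ^ 2 * S.steps₁) : ℝ) := by gcongr
        _ = _ := by field_simp; ring
  have h4 := pr_forall_not_le (ι := Fin S.steps₂) _ h3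
  rw [Fintype.card_fin] at h4
  exact (pr_mono fun y' hy' => hy'.2).trans h4

theorem pr_misses_le {x w : V} (hxw : N.graph.Adj x w) (hN : N.HasBounds k kmax Δ)
    (hS : S.Fits Δ) {B : ℝ} (hB : 0 < B)
    (h₁ : B ≤ k / 2 * (1 / (4 * c ^ 2) * (1 / 4) ^ 16) * S.steps₁)
    (h₂ : B ≤ k / 2 * (1 / (24576 * (kmax * Δ)) / 16) * S.steps₂) :
    pr (Misses (S := S) N x w) ≤ (Δ + 2) * Real.exp (-B) := by
  classical
  have hc : (1 : ℝ) ≤ c := by exact_mod_cast Nat.pos_of_neZero c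
  have hk : (1 : ℝ) ≤ k := by exact_mod_cast hN.one_le_k
  have hkk : (k : ℝ) ≤ kmax := by exact_mod_cast hN.k_le_kmax
  have hkc : (k : ℝ) ≤ c := by exact_mod_cast hN.k_le_kmax.trans hN.kmax_le_c
  have hs : (0 : ℝ) < S.steps₁ := by
    by_contra hcon
    have : (S.steps₁ : ℝ) = 0 := le_antisymm (not_lt.mp hcon) (by positivity)
    rw [this, mul_zero] at h₁
    linarith
  have hmono : ∀ {b : ℝ}, B ≤ b → Real.exp (-b) ≤ Real.exp (-B) := fun h =>
    Real.exp_le_exp.mpr (neg_le_neg h)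
  have hΔ0 : (0 : ℝ) ≤ Δ := by positivity
  have he := Real.exp_pos (-B)
  let U₁ := (sharedLabels N x w).filter fun ℓ => (nbrsOn N x ℓ).card ≤ 32 * c
  let U₂ := (sharedLabels N x w).filter fun ℓ => ¬ (nbrsOn N x ℓ).card ≤ 32 * c
  have hsum : U₁.card + U₂.card = (sharedLabels N x w).card :=
    Finset.card_filter_add_card_filter_not _
  have hshared : k ≤ (sharedLabels N x w).card := by
    rw [card_sharedLabels]; exact (hN.overlap x w hxw).1
  rcases (by omega : k ≤ 2 * U₁.card ∨ k ≤ 2 * U₂.card) with h | h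
  · have h' : (k / 2 : ℝ) ≤ U₁.card := by
      rw [div_le_iff₀ (by norm_num), mul_comm]; exact_mod_cast h
    refine (pr_misses_le_of_uncrowded N hxw hS U₁ (Finset.filter_subset _ _)
      fun ℓ hℓ => (Finset.mem_filter.mp hℓ).2).trans ((hmono (h₁.trans ?_)).trans ?_)
    · gcongr
    · nlinarith
  · have h' : (k / 2 : ℝ) ≤ U₂.card := by
      rw [div_le_iff₀ (by norm_num), mul_comm]; exact_mod_cast h
    have hne : U₂.Nonempty := by
      rw [← Finset.card_pos]
      have := hN.one_le_k
      omega
    refine (pr_misses_le_of_crowded N hxw hN hS (by exact_mod_cast hs) U₂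
      (Finset.filter_subset _ _) hne
      fun ℓ hℓ => (not_le.mp (Finset.mem_filter.mp hℓ).2).le).trans ?_
    have e1 : B ≤ kmax / c ^ 2 * S.steps₁ := by
      refine h₁.trans ?_
      gcongr
      calc (k / 2 * (1 / (4 * c ^ 2) * (1 / 4) ^ 16) : ℝ) =
          k / c ^ 2 * (1 / 8 * (1 / 4) ^ 16) := by field_simp; norm_num
        _ ≤ kmax / c ^ 2 * 1 := by
          gcongr
          norm_num
        _ = _ := mul_one _
    -- Here k ≤ c is what makes (c²/k) lg n steps enough for each single channel.
    have e2 : B ≤ S.steps₁ / (16 * c) := by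
      refine h₁.trans ?_
      calc (k / 2 * (1 / (4 * c ^ 2) * (1 / 4) ^ 16) * S.steps₁ : ℝ) ≤
          c / 2 * (1 / (4 * c ^ 2) * (1 / 4) ^ 16) * S.steps₁ := by gcongr
        _ = S.steps₁ / (16 * c) * (2 * (1 / 4) ^ 16) := by field_simp; norm_num
        _ ≤ S.steps₁ / (16 * c) * 1 := by
          gcongr
          norm_num
        _ = _ := mul_one _
    have e3 : B ≤ U₂.card * (1 / (24576 * (kmax * Δ)) / 16) * S.steps₂ := by
      refine h₂.trans ?_
      gcongr
    have h3 := mul_le_mul_of_nonneg_left (hmono e2) hΔ0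
    linarith [hmono e1, hmono e3]

end

/-! ### The numerical data of CSeek -/

theorem log_le_lg {n : ℕ} (hn : 1 ≤ n) : Real.log n ≤ lg n := by
  unfold lg Real.logb
  have h2 := Real.log_two_lt_d9
  rw [le_div_iff₀ (Real.log_pos (by norm_num))]
  have : 0 ≤ Real.log n := Real.log_nonneg (by exact_mod_cast hn)
  nlinarith

theorem one_le_lg {n : ℕ} (hn : 2 ≤ n) : 1 ≤ lg n := by
  unfold lg
  rw [Real.le_logb_iff_rpow_le (by norm_num) (by positivity), Real.rpow_one]
  exact_mod_cast hn

theorem two_pow_rounds_le {Δ : ℕ} (hΔ : 0 < Δ) : 2 ^ max 1 (Nat.clog 2 Δ) ≤ 2 * Δ := by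
  rcases Nat.lt_or_ge 1 Δ with h | h
  · have h1 : 0 < Nat.clog 2 Δ := Nat.clog_pos (by norm_num) h
    rw [max_eq_right h1]
    have h2 := Nat.pow_pred_clog_lt_self (b := 2) (by norm_num) h
    have h3 : 2 ^ Nat.clog 2 Δ = 2 * 2 ^ (Nat.clog 2 Δ - 1) := by
      rw [← pow_succ']; congr 1; omega
    rw [h3]
    have h4 : 2 ^ (Nat.clog 2 Δ - 1) ≤ Δ := h2.le
    omega
  · have : Δ = 1 := le_antisymm h hΔ
    subst this
    simp

theorem rounds_le {n Δ : ℕ} (hn : 2 ≤ n) (hΔ : Δ < n) :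
    ((max 1 (Nat.clog 2 Δ) : ℕ) : ℝ) ≤ 2 * lg n := by
  have h1 := one_le_lg hn
  rcases Nat.eq_zero_or_pos Δ with rfl | h0
  · simp; linarith
  -- From 2^rounds ≤ 2Δ ≤ 2n, the number of rounds is at most 1 + lg n.
  have h2 : ((max 1 (Nat.clog 2 Δ) : ℕ) : ℝ) ≤ Real.logb 2 (2 * n) := by
    rw [Real.le_logb_iff_rpow_le (by norm_num) (by positivity), Real.rpow_natCast]
    exact_mod_cast (two_pow_rounds_le h0).trans (by omega)
  rw [Real.logb_mul (by norm_num) (by positivity), Real.logb_self_eq_one (by norm_num)] at h2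
  unfold lg at *
  linarith

/-- From 1024 ≤ e⁷ ≤ 1120 and 0 < δ < 1, the threshold lies between 8/1120 = 1/140 and 16/1024 =
1/64. With a = 64 the error exp(-roundLen/64) is at most 1/n. -/
theorem shape_fits {n c k kmax Δ : ℕ} {δ C₁ C₂ : ℝ} (hδ0 : 0 < δ) (hδ1 : δ < 1) (hΔ : 0 < Δ)
    (hΔn : Δ < n) : (shape n c k kmax Δ δ 64 C₁ C₂).Fits Δ := by
  have hlg := one_le_lg (n := n) (by omega)
  have hlen : 64 * lg n ≤ ((shape n c k kmax Δ δ 64 C₁ C₂).roundLen : ℝ) := Nat.le_ceil _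
  have hexp : Real.exp (-7) = 1 / Real.exp 1 ^ 7 := by
    rw [← Real.exp_nat_mul, Real.exp_neg, one_div]; norm_num
  have h2 := Real.exp_one_gt_d9
  have h3 := Real.exp_one_lt_d9
  have h4 : (1024 : ℝ) ≤ Real.exp 1 ^ 7 := by
    calc (1024 : ℝ) ≤ 2.7182818283 ^ 7 := by norm_num
      _ ≤ _ := by gcongr
  have h5 : Real.exp 1 ^ 7 ≤ 1120 := by
    calc Real.exp 1 ^ 7 ≤ 2.7182818286 ^ 7 := by gcongr
      _ ≤ _ := by norm_num
  have h6 : Real.exp (-7) ≤ 1 / 1024 := by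
    rw [hexp]; exact one_div_le_one_div_of_le (by norm_num) h4
  have h7 : 1 / 1120 ≤ Real.exp (-7) := by
    rw [hexp]; exact one_div_le_one_div_of_le (by positivity) h5
  refine ⟨?_, ?_, ?_, ?_, ?_, two_pow_rounds_le hΔ, ?_⟩
  · change 1 / 140 ≤ (1 + δ) * (8 * Real.exp (-7))
    nlinarith
  · change (1 + δ) * (8 * Real.exp (-7)) ≤ 1 / 64
    nlinarith
  · exact lt_of_lt_of_le one_pos (le_max_left _ _)
  · exact_mod_cast (by linarith : (0 : ℝ) < (shape n c k kmax Δ δ 64 C₁ C₂).roundLen)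
  · exact (Nat.le_pow_clog (by norm_num) Δ).trans
      (Nat.pow_le_pow_right (by norm_num) (le_max_right _ _))
  · have hn : (0 : ℝ) < n := by exact_mod_cast (by omega : 0 < n)
    calc _ ≤ (n : ℝ) * Real.exp (-Real.log n) := by
          gcongr
          have := log_le_lg (n := n) (by omega)
          linarith
      _ = 1 := by rw [Real.exp_neg, Real.exp_log hn, mul_inv_cancel₀ hn.ne']

theorem slots_le {n c k kmax Δ : ℕ} {δ C₁ C₂ : ℝ} (hC₁ : 0 < C₁) (hC₂ : 0 < C₂)
    (hn : 0 < n) (hk : 1 ≤ k) (hkk : k ≤ kmax) (hkc : kmax ≤ c) (hΔ : Δ < n) :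
    ((shape n c k kmax Δ δ 64 C₁ C₂).slots₁ + (shape n c k kmax Δ δ 64 C₁ C₂).slots₂ : ℝ) ≤
      (130 * (C₁ + 1) + 2 * (C₂ + 1)) *
        ((c : ℝ) ^ 2 / k * lg n ^ 3 + (kmax : ℝ) / k * Δ * lg n ^ 2) := by
  have hk' : (1 : ℝ) ≤ k := by exact_mod_cast hk
  have hkk' : (k : ℝ) ≤ kmax := by exact_mod_cast hkk
  have hkc' : (k : ℝ) ≤ c := by exact_mod_cast hkk.trans hkc
  simp only [Shape.slots₁, Shape.slots₂, shape]
  rcases Nat.lt_or_ge n 2 with h1 | h2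
  -- Here lg n = 0, so both parts have no steps.
  · have : n = 1 := by omega
    subst this
    simp [lg]
  have hlg := one_le_lg h2
  have hA : 1 ≤ (c : ℝ) ^ 2 / k := by
    rw [le_div_iff₀ (by linarith)]; nlinarith
  set A := (c : ℝ) ^ 2 / k
  have hT : (⌈64 * lg n⌉₊ : ℝ) ≤ 65 * lg n := by
    have := Nat.ceil_lt_add_one (a := 64 * lg n) (by linarith)
    linarith
  -- Rounding up costs a constant factor because the quantities are at least 1. The constant 130 is
  -- 2·65, from `rounds` ≤ 2 lg n and `roundLen` ≤ 65 lg n.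
  have hR := rounds_le h2 hΔ
  have hs₁ : (⌈C₁ * (A * lg n)⌉₊ : ℝ) ≤ (C₁ + 1) * (A * lg n) := by
    have h3 : 1 ≤ A * lg n := by nlinarith
    have := Nat.ceil_lt_add_one (a := C₁ * (A * lg n)) (by positivity)
    linarith
  have hs₂ : (⌈C₂ * ((kmax : ℝ) / k * Δ * lg n)⌉₊ : ℝ) ≤
      (C₂ + 1) * ((kmax : ℝ) / k * Δ * lg n) := by
    rcases Nat.eq_zero_or_pos Δ with rfl | h0
    · simp
    have h3 : 1 ≤ (kmax : ℝ) / k := by rw [le_div_iff₀ (by linarith)]; linarith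
    have h4 : (1 : ℝ) ≤ Δ := by exact_mod_cast h0
    have h5 : 1 ≤ (kmax : ℝ) / k * Δ * lg n := one_le_mul_of_one_le_of_one_le
      (one_le_mul_of_one_le_of_one_le h3 h4) hlg
    have := Nat.ceil_lt_add_one (a := C₂ * ((kmax : ℝ) / k * Δ * lg n)) (by positivity)
    linarith
  set D := (kmax : ℝ) / k * Δ
  have hD : 0 ≤ D := by positivity
  push_cast at hR ⊢
  calc _ ≤ (C₁ + 1) * (A * lg n) * (2 * lg n * (65 * lg n)) +
        (C₂ + 1) * (D * lg n) * (2 * lg n) := by gcongr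
    _ = 130 * (C₁ + 1) * (A * lg n ^ 3) + 2 * (C₂ + 1) * (D * lg n ^ 2) := by ring
    _ ≤ (130 * (C₁ + 1) + 2 * (C₂ + 1)) * (A * lg n ^ 3) +
        (130 * (C₁ + 1) + 2 * (C₂ + 1)) * (D * lg n ^ 2) := by
        gcongr <;> linarith
    _ = _ := by ring

theorem discoveryProb_ge {V : Type u} [Fintype V] {Ch : Type v} {n c k kmax Δ : ℕ} [NeZero c]
    (N : CRNetwork V Ch c) (hn : Fintype.card V = n) (hN : N.HasBounds k kmax Δ) {δ α : ℝ}
    (hδ0 : 0 < δ) (hδ1 : δ < 1) (hα : 0 ≤ α) :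
    1 - 1 / (n : ℝ) ^ α ≤ (cseek V n c k kmax Δ δ 64 (8 * 4 ^ 16 * (α + 4))
      (786432 * (α + 4))).discoveryProb N := by
  classical
  have hΔn : Δ < n := hn ▸ hN.Δ_lt
  have hnpos : (0 : ℝ) < n := by exact_mod_cast (by omega : 0 < n)
  unfold cseek
  rcases Nat.eq_zero_or_pos Δ with h0 | h0
  · refine le_trans ?_ (one_sub_discoveryProb_le N le_rfl fun x w hxw => ?_)
    · have : 0 < (n : ℝ) ^ α := Real.rpow_pos_of_pos hnpos α
      simp only [mul_zero, sub_zero, tsub_le_iff_right, le_add_iff_nonneg_right]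
      positivity
    · have h1 := card_nbrs_le N hN x
      have h2 : 0 < (nbrs N x).card := Finset.card_pos.mpr ⟨w, (mem_nbrs N).mpr hxw⟩
      omega
  have h2 : 2 ≤ n := by omega
  have hlg := one_le_lg h2
  have hS := shape_fits (n := n) (c := c) (k := k) (kmax := kmax) (C₁ := 8 * 4 ^ 16 * (α + 4))
    (C₂ := 786432 * (α + 4)) hδ0 hδ1 h0 hΔn
  set S := shape n c k kmax Δ δ 64 (8 * 4 ^ 16 * (α + 4)) (786432 * (α + 4)) with hSdef
  have hk : (1 : ℝ) ≤ k := by exact_mod_cast hN.one_le_k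
  have hkk : (k : ℝ) ≤ kmax := by exact_mod_cast hN.k_le_kmax
  have hc : (1 : ℝ) ≤ c := by exact_mod_cast Nat.pos_of_neZero c
  have hΔ : (1 : ℝ) ≤ Δ := by exact_mod_cast h0
  have hs₁ : 8 * 4 ^ 16 * (α + 4) * ((c : ℝ) ^ 2 / k * lg n) ≤ S.steps₁ := Nat.le_ceil _
  have hs₂ : 786432 * (α + 4) * ((kmax : ℝ) / k * Δ * lg n) ≤ S.steps₂ := Nat.le_ceil _
  have hkmax : (0 : ℝ) < kmax := by linarith
  -- C₁ and C₂ invert the success rates per step: 8·4^16 = 2·4·4^16 and 786432 = 2·16·24576. Of the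
  -- exponent α+4, two powers of n pay for the pairs and two for Δ+2 ≤ n².
  have key : ∀ x w, N.graph.Adj x w → pr (Misses (S := S) N x w) ≤
      (Δ + 2) * Real.exp (-((α + 4) * lg n)) := fun x w hxw => by
    refine pr_misses_le N hxw hN hS (by positivity) ?_ ?_
    · calc (α + 4) * lg n = k / 2 * (1 / (4 * c ^ 2) * (1 / 4) ^ 16) *
            (8 * 4 ^ 16 * (α + 4) * ((c : ℝ) ^ 2 / k * lg n)) := by field_simp; norm_num
        _ ≤ _ := by gcongr
    · calc (α + 4) * lg n = k / 2 * (1 / (24576 * (kmax * Δ)) / 16) *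
            (786432 * (α + 4) * ((kmax : ℝ) / k * Δ * lg n)) := by field_simp; norm_num
        _ ≤ _ := by gcongr
  refine le_trans ?_ (one_sub_discoveryProb_le N (by positivity) key)
  rw [hn]
  have hexp : Real.exp (-((α + 4) * lg n)) ≤ 1 / ((n : ℝ) ^ α * n ^ 4) := by
    have h3 := log_le_lg (n := n) (by omega)
    calc _ ≤ Real.exp (-((α + 4) * Real.log n)) := by gcongr
      _ = _ := by
        rw [Real.exp_neg, one_div, mul_comm, ← Real.rpow_def_of_pos hnpos,
          Real.rpow_add hnpos]
        norm_cast
  have hpow : 0 < (n : ℝ) ^ α := Real.rpow_pos_of_pos hnpos α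
  have hnn : (Δ + 2 : ℝ) ≤ n ^ 2 := by
    have h4 : (Δ + 1 : ℝ) ≤ n := by exact_mod_cast hΔn
    have h5 : (2 : ℝ) ≤ n := by exact_mod_cast h2
    nlinarith
  have : (n : ℝ) ^ 2 * ((Δ + 2) * Real.exp (-((α + 4) * lg n))) ≤ 1 / (n : ℝ) ^ α := by
    calc _ ≤ (n : ℝ) ^ 2 * (n ^ 2 * (1 / ((n : ℝ) ^ α * n ^ 4))) := by gcongr
      _ = _ := by field_simp
  linarith

end CSeek

theorem mainTheorem1 :
    ∃ δ₀ : ℝ, 0 < δ₀ ∧ δ₀ ≤ 1 ∧ ∀ δ : ℝ, 0 < δ → δ < δ₀ → ∀ α : ℝ, 1 ≤ α →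
    ∃ a C₁ C₂ C : ℝ, 0 < a ∧ 0 < C₁ ∧ 0 < C₂ ∧ 0 < C ∧
      ∀ (V : Type u) [Fintype V] (Ch : Type v) (n c k kmax Δ : ℕ) [NeZero c]
        (N : CRNetwork V Ch c), Fintype.card V = n → N.HasBounds k kmax Δ →
        ((cseek V n c k kmax Δ δ a C₁ C₂).slots : ℝ) ≤
            C * ((c : ℝ) ^ 2 / k * lg n ^ 3 + (kmax : ℝ) / k * Δ * lg n ^ 2) ∧
        ((cseek V n c k kmax Δ δ a C₁ C₂).slots : ℝ) ≤
            C * ((c : ℝ) ^ 2 / k + (kmax : ℝ) / k * Δ) * lg n ^ 3 ∧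
        1 - 1 / (n : ℝ) ^ α ≤ (cseek V n c k kmax Δ δ a C₁ C₂).discoveryProb N := by
  -- Every δ < 1 works, since it only has to keep the threshold below 1/64.
  refine ⟨1, one_pos, le_rfl, fun δ hδ0 hδ1 α hα => ⟨64, 8 * 4 ^ 16 * (α + 4), 786432 * (α + 4),
    130 * (8 * 4 ^ 16 * (α + 4) + 1) + 2 * (786432 * (α + 4) + 1), by norm_num, by positivity,
    by positivity, by positivity, ?_⟩⟩
  intro V _ Ch n c k kmax Δ _ N hn hN
  have hΔn : Δ < n := hn ▸ hN.Δ_lt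
  have h1 := CSeek.slots_le (n := n) (c := c) (k := k) (kmax := kmax) (Δ := Δ) (δ := δ)
    (C₁ := 8 * 4 ^ 16 * (α + 4)) (C₂ := 786432 * (α + 4)) (by positivity) (by positivity)
    (by omega) hN.one_le_k hN.k_le_kmax hN.kmax_le_c hΔn
  rw [← Nat.cast_add] at h1
  refine ⟨h1, h1.trans ?_, CSeek.discoveryProb_ge N hn hN hδ0 hδ1 (by linarith)⟩
  have h2 : (kmax : ℝ) / k * Δ * lg n ^ 2 ≤ (kmax : ℝ) / k * Δ * lg n ^ 3 := by
    rcases Nat.lt_or_ge n 2 with h | h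
    · have : n = 1 := by omega
      subst this
      simp [lg]
    · gcongr
      · exact CSeek.one_le_lg h
      · norm_num
  calc _ ≤ _ := mul_le_mul_of_nonneg_left (add_le_add_right h2 _) (by positivity)
    _ = _ := by ring
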